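/- **Setting.** Let $X$ be a real Banach space, $\Omega\subset X$ open, and $Y$ an infinite-dimensional real vector space. For every $x$ let $Q(x,\cdot)$ be a quadratic form on $Y$ and $G(x,\cdot)$ a quadratic form with domain a linear subspace $H(x)\subset Y$ ($G(x,\cdot)=+\infty$ outside $H(x)$); let $B(x,\cdot,\cdot)$ and $\Gamma(x,\cdot,\cdot)$ be the associated bilinear forms, and put $\mathcal R(x,u)=G(x,u)/Q(x,u)$ for $u\in H(x)\setminus\{0\}$. A subscript $x$ (as in $Q_x$, $G_x$, $B_x$, $\Gamma_x$, $\mathrm{sc}_x$) denotes the Fréchet derivative in the variable $x$, an element of $X^*$. Assume that at every $x\in\Omega$: $Q(x,\cdot)$ is positive definite and $H(x)$ is $Q^{1/2}(x,\cdot)$-dense in $Y$; $Q(\cdot,u)$ and $G(\cdot,v)$ are Fréchet differentiable at $x$ for all $u\in Y$, $v\in H(x)$; and there are a neighborhood $V\subset\Omega$ of $x$ and a bounded function $\theta:V\to(0,+\infty)$ such that, with $N(x',\cdot):=(G(x',\cdot)+\theta(x')Q(x',\cdot))^{1/2}$ for $x'\in V$: * $N(x',\cdot)$ is a Hilbert norm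 on $H(x')$ for every $x'\in V$; * for some $C\ge1$ and all $x'\in V$, $H(x')=H(x)$ and $C^{-1}N(x',\cdot)\le N(x,\cdot)\le C\,N(x',\cdot)$ on $H(x)$; * if $x_n\in V$, $x_n\to x$, $u_n\in H(x_n)$ and $\sup_nN(x_n,u_n)<\infty$, then there is $u\in H(x)$ such that, along a subsequence, $Q(x_n,u_n-u)\to0$ and $\Gamma(x_n,u_n,h)\to\Gamma(x,u,h)$ for all $h\in H(x)$; * if $x_n\in V$, $x_n\to x$, $u_n,u\in Y$ and $Q(x_n,u_n-u)\to0$, then $Q(x_n,u_n)\to Q(x,u)$ and $Q_x(x_n,u_n)\to Q_x(x,u)$ in $X^*$; if $x_n\in V$, $x_n\to x$, $v_n\in H(x_n)$, $v\in H(x)$ and $N(x_n,v_n-v)\to0$, then $G(x_n,v_n)\to G(x,v)$ and $G_x(x_n,v_n)\to G_x(x,v)$ in $X^*$; * for some $C_0>0$, all $x'\in V$ and all $u,v\in H(x')$, $\|B_x(x',u,v)\|_{X^*}\le C_0N(x',u)N(x',v)$ and $\|\Gamma_x(x',u,v)\|_{X^*}\le C_0N(x',u)N(x',v)$. For $k\ge1$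 let $\lambda_k(x)=\min_E\max_{u\in E,\,Q(x,u)=1}\mathcal R(x,u)$, where $E$ runs over the $k$-dimensional subspaces of $H(x)$, and $E_k(x)=\{u\in H(x):\Gamma(x,u,v)=\lambda_k(x)B(x,u,v)\ \forall v\in H(x)\}$. Let $\mu_1(x)<\mu_2(x)<\cdots$ be the distinct values of the sequence $(\lambda_k(x))_{k\ge1}$, $\aleph_i(x)=\{k\ge1:\lambda_k(x)=\mu_i(x)\}$, and, for $N\ge1$, let $i_N(x)$ be the index with $\mu_{i_N(x)}(x)=\lambda_N(x)$ and $J_N(x)=\max\aleph_{i_N(x)}(x)$. Let $\mathcal U_n(x)$ (resp. $\mathbf U_n(x)$) be the set of $Q(x,\cdot)$-orthogonal (resp. $Q(x,\cdot)$-orthonormal) families $(u_1,\dots,u_n)$ with $u_k\in E_k(x)$. For a finite tuple $d$ of reals, $\mathrm{Mix}(d)$ is the convex hull of all tuples obtained by permuting the entries of $d$; $d_A$ denotes $(d_k)_{k\in A}$. Let $\mathrm{sc}:\Omega\to(0,+\infty)$ be of class $C^1$, $\overline\lambda_k=\mathrm{sc}\,\lambda_k$, $N\ge1$, $F\in C^1(\mathbb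 R^N,\mathbb R)$ and $\mathfrak F(x)=F(\overline\lambda_1(x),\dots,\overline\lambda_N(x))$. Put $d_k(x)=\partial_kF(\overline\lambda_1(x),\dots,\overline\lambda_N(x))$ for $1\le k\le N$ and $d_k(x)=0$ for $k>N$, $S(x)=\sum_{k=1}^Nd_k(x)\lambda_k(x)$, and $c(x)=0$ if $S(x)=0$, $c(x)=S(x)/|S(x)|$ otherwise. A point $x\in\Omega$ is *critical* for $\mathfrak F$ if $$\limsup_{y\to x,\ t\downarrow0}\frac{\mathfrak F(y+th)-\mathfrak F(y)}t\ge0\ \ \forall h\in X\qquad\text{or}\qquad\liminf_{y\to x,\ t\downarrow0}\frac{\mathfrak F(y+th)-\mathfrak F(y)}t\le0\ \ \forall h\in X,$$ i.e. if $0$ belongs to the Clarke subdifferential or to the Clarke superdifferential of $\mathfrak F$ at $x$. **Theorem.** Let $x\in\Omega$ be critical for $\mathfrak F$. Then there are $(u_k)\in\mathbf U_{J_N(x)}(x)$, $\tilde d\in\prod_{i=1}^{i_N(x)}\mathrm{Mix}(d_{\aleph_i(x)}(x))$, $(\phi_k)\in\mathcal U_{J_N(x)}(x)$ and $(\varepsilon_k)\in\{0,\pm1\}^{J_N(x)}$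 such that: (A) $\displaystyle\sum_{k=1}^{J_N(x)}\tilde d_k\,G_x(x,u_k)+\frac{\mathrm{sc}_x(x)}{\mathrm{sc}(x)}S(x)=\sum_{i=1}^{i_N(x)}\mu_i(x)\sum_{k\in\aleph_i(x)}\tilde d_k\,Q_x(x,u_k)$; (B) $\displaystyle\sum_{k=1}^{J_N(x)}\varepsilon_k\,G_x(x,\phi_k)+\frac{\mathrm{sc}_x(x)}{\mathrm{sc}(x)}c(x)=\sum_{i=1}^{i_N(x)}\mu_i(x)\sum_{k\in\aleph_i(x)}\varepsilon_k\,Q_x(x,\phi_k)$; (C) for every $k\in\{1,\dots,J_N(x)\}$, $Q(x,\phi_k)=|\tilde d_k|$ if $S(x)=0$, and $Q(x,\phi_k)=|\tilde d_k|/|S(x)|$ otherwise; (D) for every $i\in\{1,\dots,i_N(x)\}$ such that $d_k(x)>0$ for all $k\in\aleph_i(x)$, one has $\tilde d_k>0$ and $\varepsilon_k=1$ for all $k\in\aleph_i(x)$. -/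

import Mathlib

open Filter Topology

/-- `Mix d` is the convex hull of the tuples obtained from `d` by permuting its entries. -/
def Mix {ι : Type*} (d : ι → ℝ) : Set (ι → ℝ) :=
  convexHull ℝ (Set.range fun σ : Equiv.Perm ι => d ∘ σ)

section Clarke

variable {X : Type*} [NormedAddCommGroup X] [NormedSpace ℝ X]

/-- Generalized upper directional derivative: the upper limit of `(f (y + t h) - f y) / t`
as `y → x` and `t ↓ 0`, computed in the extended reals. -/
noncomputable def clarkeUpper (f : X → ℝ) (x h : X) : EReal :=
  limsup (fun p : X × ℝ => (((f (p.1 + p.2 • h) - f p.1) / p.2 : ℝ) : EReal))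
    (𝓝 x ×ˢ 𝓝[>] (0 : ℝ))

/-- Generalized lower directional derivative: the lower limit of the same quotients. -/
noncomputable def clarkeLower (f : X → ℝ) (x h : X) : EReal :=
  liminf (fun p : X × ℝ => (((f (p.1 + p.2 • h) - f p.1) / p.2 : ℝ) : EReal))
    (𝓝 x ×ˢ 𝓝[>] (0 : ℝ))

/-- Clarke subdifferential. -/
def clarkeSub (f : X → ℝ) (x : X) : Set (X →L[ℝ] ℝ) :=
  {ζ | ∀ h : X, ((ζ h : ℝ) : EReal) ≤ clarkeUpper f x h}

/-- Clarke superdifferential. -/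
def clarkeSuper (f : X → ℝ) (x : X) : Set (X →L[ℝ] ℝ) :=
  {ζ | ∀ h : X, clarkeLower f x h ≤ ((ζ h : ℝ) : EReal)}

/-- `x` is critical for `f` when `0` is in the Clarke subdifferential or superdifferential. -/
def IsClarkeCritical (f : X → ℝ) (x : X) : Prop :=
  (0 : X →L[ℝ] ℝ) ∈ clarkeSub f x ∪ clarkeSuper f x

end Clarke

/-- A family, indexed by the parameter `x : X`, of pairs of quadratic forms: `Q x` is defined on
all of `Y`, and `G x` has the subspace `H x` of `Y` as its domain (`G x = +∞` outside of it).
Only parameters in some open set will matter. -/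
structure RayleighFamily (X Y : Type*) [AddCommGroup Y] [Module ℝ Y] where
  Q : X → QuadraticForm ℝ Y
  H : X → Submodule ℝ Y
  G : (x : X) → QuadraticForm ℝ (H x)

namespace RayleighFamily

section Basic

variable {X Y : Type*} [AddCommGroup Y] [Module ℝ Y] (R : RayleighFamily X Y)

open Classical in
/-- The value of `G x` at `v ∈ H x` (and `0` if `v ∉ H x`, a value that is never used). -/
noncomputable def Gval (x : X) (v : Y) : ℝ :=
  if h : v ∈ R.H x then R.G x ⟨v, h⟩ else 0

/-- The bilinear form `B(x, u, v)` associated with `Q(x, ·)`. -/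
noncomputable def B (x : X) (u v : Y) : ℝ :=
  (R.Q x (u + v) - R.Q x u - R.Q x v) / 2

/-- The bilinear form `Γ(x, u, v)` associated with `G(x, ·)`, for `u v ∈ H x`. -/
noncomputable def Gam (x : X) (u v : Y) : ℝ :=
  (R.Gval x (u + v) - R.Gval x u - R.Gval x v) / 2

/-- The Rayleigh quotient at a nonzero `u ∈ H x`. -/
noncomputable def rayleigh (x : X) (u : Y) : ℝ := R.Gval x u / R.Q x u

/-- The norm `N(x, u) = (G(x, u) + θ(x) Q(x, u))^{1/2}`, for `u ∈ H x`. -/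
noncomputable def nrm (θ : X → ℝ) (x : X) (u : Y) : ℝ :=
  Real.sqrt (R.Gval x u + θ x * R.Q x u)

/-- The `k`-th eigenvalue `λ_k(x)`, `k ≥ 1`, by the min-max formula: the infimum over the
`k`-dimensional subspaces `E` of `H x` of the supremum of the Rayleigh quotient over the
`Q x`-unit sphere of `E`. -/
noncomputable def lam (k : ℕ) (x : X) : ℝ :=
  sInf {a : ℝ | ∃ E : Submodule ℝ Y, E ≤ R.H x ∧ Module.finrank ℝ E = k ∧
    a = sSup (R.rayleigh x '' {u : Y | u ∈ E ∧ R.Q x u = 1})}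

/-- `E_k(x)`: the `u ∈ H x` with `L(x) u = λ_k(x) u`, where `L(x) u = γ` means that
`Γ(x, u, v) = B(x, γ, v)` for all `v ∈ H x`. -/
def eigenspace (k : ℕ) (x : X) : Set Y :=
  {u | u ∈ R.H x ∧ ∀ v ∈ R.H x, R.Gam x u v = R.B x (R.lam k x • u) v}

/-- `μ_i(x)`, `i ≥ 1`: the distinct values of `k ↦ λ_k(x)`, `k ≥ 1`, in increasing order.
(The value at `i = 0` is never used.) -/
noncomputable def mu (x : X) : ℕ → ℝ
  | 0 => 0
  | 1 => sInf {a : ℝ | ∃ k : ℕ, 1 ≤ k ∧ a = R.lam k x}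
  | i + 2 => sInf {a : ℝ | (∃ k : ℕ, 1 ≤ k ∧ a = R.lam k x) ∧ mu x (i + 1) < a}

/-- `ℵ_i(x)`: the set of indices `k ≥ 1` such that `λ_k(x) = μ_i(x)`. -/
def aleph (i : ℕ) (x : X) : Set ℕ := {k | 1 ≤ k ∧ R.lam k x = R.mu x i}

/-- `i_k(x)`: the index `i ≥ 1` such that `μ_i(x) = λ_k(x)`. -/
noncomputable def clusterIdx (k : ℕ) (x : X) : ℕ :=
  sInf {i : ℕ | 1 ≤ i ∧ R.mu x i = R.lam k x}

/-- The highest index `l` such that `λ_l(x) = λ_k(x)`. -/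
noncomputable def topIdx (k : ℕ) (x : X) : ℕ := sSup (R.aleph (R.clusterIdx k x) x)

/-- `(u_1, …, u_n)` is a `Q x`-orthogonal family with `u_k ∈ E_k(x)`. (Vectors `u_k` with
`k ∉ {1, …, n}` are irrelevant.) -/
def OrthogonalFamily (x : X) (n : ℕ) (u : ℕ → Y) : Prop :=
  (∀ k ∈ Finset.Icc 1 n, u k ∈ R.eigenspace k x) ∧
    ∀ k ∈ Finset.Icc 1 n, ∀ l ∈ Finset.Icc 1 n, k ≠ l → R.B x (u k) (u l) = 0

/-- `(u_1, …, u_n)` is a `Q x`-orthonormal family with `u_k ∈ E_k(x)`. -/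
def OrthonormalFamily (x : X) (n : ℕ) (u : ℕ → Y) : Prop :=
  R.OrthogonalFamily x n u ∧ ∀ k ∈ Finset.Icc 1 n, R.Q x (u k) = 1

end Basic

section Deriv

variable {X Y : Type*} [NormedAddCommGroup X] [NormedSpace ℝ X] [AddCommGroup Y] [Module ℝ Y]
  (R : RayleighFamily X Y)

/-- `Q_x(x, u)`: the Fréchet derivative at `x` of `y ↦ Q(y, u)`. -/
noncomputable def Qx (x : X) (u : Y) : X →L[ℝ] ℝ := fderiv ℝ (fun y => R.Q y u) x

/-- `G_x(x, v)`: the Fréchet derivative at `x` of `y ↦ G(y, v)`. -/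
noncomputable def Gx (x : X) (v : Y) : X →L[ℝ] ℝ := fderiv ℝ (fun y => R.Gval y v) x

/-- `B_x(x, u, v)`: the Fréchet derivative at `x` of `y ↦ B(y, u, v)`. -/
noncomputable def Bx (x : X) (u v : Y) : X →L[ℝ] ℝ := fderiv ℝ (fun y => R.B y u v) x

/-- `Γ_x(x, u, v)`: the Fréchet derivative at `x` of `y ↦ Γ(y, u, v)`. -/
noncomputable def Gamx (x : X) (u v : Y) : X →L[ℝ] ℝ := fderiv ℝ (fun y => R.Gam y u v) x

/-- The assumptions at the point `x` that involve the norms `N(x', ·)`, `x' ∈ V`, for a given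
neighborhood `V` of `x` and a given function `θ` on `V`. Recall that `N(x', u) = +∞` when
`u ∉ H x'`, so that inequalities between norms include inclusions between domains. -/
structure LocalAssumptions (V : Set X) (θ : X → ℝ) (x : X) : Prop where
  theta_pos : ∀ x' ∈ V, 0 < θ x'
  theta_bdd : ∃ M : ℝ, ∀ x' ∈ V, θ x' ≤ M
  /-- `N(x', ·)` comes from a scalar product on `H x'` … -/
  nrm_posDef : ∀ x' ∈ V, ∀ u ∈ R.H x', u ≠ 0 → 0 < R.Gval x' u + θ x' * R.Q x' u
  /-- … for which `H x'` is complete. -/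
  nrm_complete : ∀ x' ∈ V, ∀ u : ℕ → Y, (∀ n, u n ∈ R.H x') →
    (∀ ε > 0, ∃ n₀ : ℕ, ∀ m ≥ n₀, ∀ n ≥ n₀, R.nrm θ x' (u m - u n) < ε) →
    ∃ v ∈ R.H x', Tendsto (fun n => R.nrm θ x' (u n - v)) atTop (𝓝 0)
  /-- The norms `N(x', ·)` are uniformly equivalent to `N(x, ·)`. -/
  nrm_equiv : ∃ C : ℝ, 1 ≤ C ∧ ∀ x' ∈ V, R.H x' = R.H x ∧
    ∀ u ∈ R.H x, C⁻¹ * R.nrm θ x' u ≤ R.nrm θ x u ∧ R.nrm θ x u ≤ C * R.nrm θ x' u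
  /-- Compactness. -/
  compactness : ∀ (xs : ℕ → X) (us : ℕ → Y), (∀ n, xs n ∈ V) → Tendsto xs atTop (𝓝 x) →
    (∀ n, us n ∈ R.H (xs n)) → (∃ M : ℝ, ∀ n, R.nrm θ (xs n) (us n) ≤ M) →
    ∃ u ∈ R.H x, ∃ s : ℕ → ℕ, StrictMono s ∧
      Tendsto (fun n => R.Q (xs (s n)) (us (s n) - u)) atTop (𝓝 0) ∧
      ∀ h ∈ R.H x, Tendsto (fun n => R.Gam (xs (s n)) (us (s n)) h) atTop (𝓝 (R.Gam x u h))
  /-- Joint continuity of `Q` and `Q_x`. -/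
  cont_Q : ∀ (xs : ℕ → X) (us : ℕ → Y) (u : Y), (∀ n, xs n ∈ V) → Tendsto xs atTop (𝓝 x) →
    Tendsto (fun n => R.Q (xs n) (us n - u)) atTop (𝓝 0) →
    Tendsto (fun n => R.Q (xs n) (us n)) atTop (𝓝 (R.Q x u)) ∧
      Tendsto (fun n => R.Qx (xs n) (us n)) atTop (𝓝 (R.Qx x u))
  /-- Joint continuity of `G` and `G_x`. -/
  cont_G : ∀ (xs : ℕ → X) (vs : ℕ → Y) (v : Y), (∀ n, xs n ∈ V) → Tendsto xs atTop (𝓝 x) →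
    (∀ n, vs n ∈ R.H (xs n)) → v ∈ R.H x →
    Tendsto (fun n => R.nrm θ (xs n) (vs n - v)) atTop (𝓝 0) →
    Tendsto (fun n => R.Gval (xs n) (vs n)) atTop (𝓝 (R.Gval x v)) ∧
      Tendsto (fun n => R.Gx (xs n) (vs n)) atTop (𝓝 (R.Gx x v))
  /-- Bounds on the derivatives. -/
  deriv_bound : ∃ C₀ : ℝ, 0 < C₀ ∧ ∀ x' ∈ V, ∀ u ∈ R.H x', ∀ v ∈ R.H x',
    ‖R.Bx x' u v‖ ≤ C₀ * (R.nrm θ x' u * R.nrm θ x' v) ∧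
    ‖R.Gamx x' u v‖ ≤ C₀ * (R.nrm θ x' u * R.nrm θ x' v)

/-- The standing assumptions on the family of Rayleigh quotients `G / Q` over `Ω`. -/
structure StandingAssumptions (Ω : Set X) : Prop where
  Q_posDef : ∀ x ∈ Ω, (R.Q x).PosDef
  /-- `H x` is `Q^{1/2}(x, ·)`-dense in `Y`. -/
  H_dense : ∀ x ∈ Ω, ∀ y : Y, ∀ ε > 0, ∃ u ∈ R.H x, R.Q x (y - u) < ε
  diff_Q : ∀ x ∈ Ω, ∀ u : Y, DifferentiableAt ℝ (fun y => R.Q y u) x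
  diff_G : ∀ x ∈ Ω, ∀ v ∈ R.H x, DifferentiableAt ℝ (fun y => R.Gval y v) x
  loc : ∀ x ∈ Ω, ∃ V ∈ 𝓝 x, V ⊆ Ω ∧ ∃ θ : X → ℝ, R.LocalAssumptions V θ x

end Deriv

section Functional

variable {X Y : Type*} [AddCommGroup Y] [Module ℝ Y] (R : RayleighFamily X Y)

/-- The tuple `(sc λ_1, …, sc λ_N)(x)` of the first `N` rescaled eigenvalues. -/
noncomputable def scaledLam (sc : X → ℝ) (N : ℕ) (x : X) : Fin N → ℝ :=
  fun i => sc x * R.lam (i.val + 1) x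

/-- The eigenvalue functional `F(sc λ_1, …, sc λ_N)`. -/
noncomputable def functional (sc : X → ℝ) {N : ℕ} (F : (Fin N → ℝ) → ℝ) (x : X) : ℝ :=
  F (R.scaledLam sc N x)

/-- `d_k(x)`: the partial derivative `∂_k F` at the rescaled eigenvalues if `1 ≤ k ≤ N`, and `0`
otherwise. -/
noncomputable def dcoef (sc : X → ℝ) {N : ℕ} (F : (Fin N → ℝ) → ℝ) (x : X) (k : ℕ) : ℝ :=
  if h : 1 ≤ k ∧ k ≤ N then
    fderiv ℝ F (R.scaledLam sc N x) (Pi.single (⟨k - 1, by omega⟩ : Fin N) 1)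
  else 0

/-- `S(x) = ∑_{k=1}^N d_k(x) λ_k(x)`. -/
noncomputable def Ssum (sc : X → ℝ) {N : ℕ} (F : (Fin N → ℝ) → ℝ) (x : X) : ℝ :=
  ∑ k ∈ Finset.Icc 1 N, R.dcoef sc F x k * R.lam k x

open Classical in
/-- `c(x)`: the sign of `S(x)`. -/
noncomputable def csign (sc : X → ℝ) {N : ℕ} (F : (Fin N → ℝ) → ℝ) (x : X) : ℝ :=
  if R.Ssum sc F x = 0 then 0 else R.Ssum sc F x / |R.Ssum sc F x|

end Functional

end RayleighFamily

/-!
The idea is that the eigenvalue functional, although not differentiable, has along every ray and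
at every point a sequence of difference quotients converging to a "first-order variation"
`∑ k, d_k (sc_x λ_k + sc (G_x(u_k) - λ_k Q_x(u_k)))`, for some orthonormal family `u` of
eigenvectors at that point (`exists_subseq_slope_functional`). This only needs compactness of the
eigenvectors: if `u_t` is an eigenvector at `x + t h` and `u` is its limit, one tests the equation
of `u_t` with `u`, the equation of `u` with `u_t`, and subtracts (`exists_subseq_slope`).

If all first-order variations at `x` in a direction `h` were negative, then by compactness those
at nearby points would be bounded away from `0`, and the mean value inequality for Dini
derivatives on short segments would make the generalized directional derivative negative. So when
`0` is in the Clarke subdifferential, every direction `h` has some orthonormal family of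
eigenvectors at `x` with nonnegative variation (`exists_functionalVar_nonneg`). The family depends
on `h`; to remove this dependence, write the variations in a fixed eigenbasis. On each eigenspace
they are the pairings of the form `G_x - μ_i Q_x` with the symmetric matrices `Oᵀ diag(d) O`, `O`
orthogonal. By Birkhoff's theorem these belong to the compact convex set (`mixedMatrices`) of the
symmetric matrices whose diagonal in every orthonormal basis is in `Mix d`. Separating this convex set from the kernel
of the pairing by the Hahn–Banach theorem yields a single matrix of the set annihilated in all
directions (`exists_mix_eq_zero`), and diagonalizing it gives (A).

The superdifferential is treated by changing the sign of `F`. The family `φ` in (B) is obtained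
from `u` by rescaling with the square roots of the `|dt_k|`, and `ε` consists of the signs of the
`dt_k`.

The spectral theory at a fixed point (an orthonormal sequence of eigenvectors whose eigenvalues
are the min-max values and tend to `+∞`) comes from successive constrained minimization of the
Rayleigh quotient, for which the compactness hypothesis suffices.
-/

/-! ### Spectral theory of a compact pair of bilinear forms -/

/-- A pair `(b, g)` of symmetric bilinear forms on a real vector space such that `b` is positive
definite, `g + θ b` is nonnegative, and sets bounded for `g + θ b` are relatively sequentially
compact (strongly for `b`, weakly for `g`). -/
structure IsCompactPair {H : Type*} [AddCommGroup H] [Module ℝ H]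
    (b g : LinearMap.BilinForm ℝ H) (θ : ℝ) : Prop where
  b_symm : ∀ u v, b u v = b v u
  g_symm : ∀ u v, g u v = g v u
  b_pos : ∀ u, u ≠ 0 → 0 < b u u
  nonneg : ∀ u, 0 ≤ g u u + θ * b u u
  compact : ∀ us : ℕ → H, (∃ M : ℝ, ∀ n, g (us n) (us n) + θ * b (us n) (us n) ≤ M) →
    ∃ u, ∃ s : ℕ → ℕ, StrictMono s ∧
      Tendsto (fun n => b (us (s n) - u) (us (s n) - u)) atTop (𝓝 0) ∧
      ∀ h, Tendsto (fun n => g (us (s n)) h) atTop (𝓝 (g u h))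

namespace IsCompactPair

variable {H : Type*} [AddCommGroup H] [Module ℝ H] {b g : LinearMap.BilinForm ℝ H} {θ : ℝ}

lemma b_nonneg (h : IsCompactPair b g θ) (u : H) : 0 ≤ b u u := by
  by_cases hu : u = 0
  · simp [hu]
  · exact (h.b_pos u hu).le

lemma tendsto_b (h : IsCompactPair b g θ) {us : ℕ → H} {u : H}
    (hu : Tendsto (fun n => b (us n - u) (us n - u)) atTop (𝓝 0)) (f : H) :
    Tendsto (fun n => b f (us n)) atTop (𝓝 (b f u)) := by
  rw [tendsto_iff_norm_sub_tendsto_zero]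
  have hbd : ∀ n, ‖b f (us n) - b f u‖ ≤ √(b f f * b (us n - u) (us n - u)) := by
    intro n
    have := LinearMap.BilinForm.apply_sq_le_of_symm b h.b_nonneg ⟨h.b_symm⟩ f (us n - u)
    rw [map_sub] at this
    exact Real.abs_le_sqrt this
  refine squeeze_zero (fun n => norm_nonneg _) hbd ?_
  have := (hu.const_mul (b f f)).sqrt
  simpa using this

lemma tendsto_b_self (h : IsCompactPair b g θ) {us : ℕ → H} {u : H}
    (hu : Tendsto (fun n => b (us n - u) (us n - u)) atTop (𝓝 0)) :
    Tendsto (fun n => b (us n) (us n)) atTop (𝓝 (b u u)) := by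
  have h1 := h.tendsto_b hu u
  have := (hu.add (h1.const_mul 2)).sub_const (b u u)
  refine (this.congr fun n => ?_).trans (by ring_nf; exact le_rfl)
  simp only [map_sub, LinearMap.sub_apply, h.b_symm (us n) u]
  ring

/-- Constrained minimization of the Rayleigh quotient on the `b`-orthogonal complement
of a set. -/
lemma exists_min (h : IsCompactPair b g θ) (S : Set H)
    (hne : ∃ w, w ≠ 0 ∧ ∀ f ∈ S, b f w = 0) :
    ∃ e, b e e = 1 ∧ (∀ f ∈ S, b f e = 0) ∧
      ∀ w, (∀ f ∈ S, b f w = 0) → g e e * b w w ≤ g w w := by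
  have hnorm : ∀ w, w ≠ 0 → b ((√(b w w))⁻¹ • w) ((√(b w w))⁻¹ • w) = 1 := by
    intro w hw
    have hp := h.b_pos w hw
    simp only [map_smul, LinearMap.smul_apply, smul_eq_mul]
    rw [← mul_assoc, ← mul_inv, Real.mul_self_sqrt hp.le, inv_mul_cancel₀ hp.ne']
  let A : Set ℝ := {a | ∃ w, b w w = 1 ∧ (∀ f ∈ S, b f w = 0) ∧ a = g w w}
  have hA : A.Nonempty := by
    obtain ⟨w, hw, hwS⟩ := hne
    exact ⟨_, _, hnorm w hw, fun f hf => by simp [hwS f hf], rfl⟩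
  have hAb : BddBelow A := by
    refine ⟨-θ, ?_⟩
    rintro a ⟨w, hw, -, rfl⟩
    have := h.nonneg w
    rw [hw] at this
    linarith
  obtain ⟨a, -, ha, haA⟩ := exists_seq_tendsto_sInf hA hAb
  choose us hus1 husS husa using haA
  obtain ⟨M, hM⟩ := ha.bddAbove_range
  obtain ⟨u, s, hs, hu, hug⟩ := h.compact us ⟨M + θ, fun n => by
    rw [hus1, ← husa, mul_one]
    linarith [hM (Set.mem_range_self n)]⟩
  have h1 : b u u = 1 := by
    refine tendsto_nhds_unique (h.tendsto_b_self hu) ?_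
    simp [hus1]
  have hS : ∀ f ∈ S, b f u = 0 := by
    intro f hf
    refine tendsto_nhds_unique (h.tendsto_b hu f) ?_
    simp [husS _ f hf]
  -- lower semicontinuity: expand `0 ≤ (g + θ b)(us - u)`
  have hle : g u u ≤ sInf A := by
    have l1 : Tendsto (fun n => 2 * g (us (s n)) u - g u u
        - θ * b (us (s n) - u) (us (s n) - u)) atTop (𝓝 (2 * g u u - g u u - θ * 0)) :=
      (((hug u).const_mul 2).sub_const _).sub (hu.const_mul θ)
    have := le_of_tendsto_of_tendsto' l1 (ha.comp hs.tendsto_atTop) (fun n => by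
      have := h.nonneg (us (s n) - u)
      simp only [Function.comp, husa]
      have e : g (us (s n) - u) (us (s n) - u)
          = g (us (s n)) (us (s n)) - 2 * g (us (s n)) u + g u u := by
        simp only [map_sub, LinearMap.sub_apply, h.g_symm u (us (s n))]
        ring
      linarith)
    linarith
  refine ⟨u, h1, hS, fun w hw => ?_⟩
  by_cases hw0 : w = 0
  · simp [hw0]
  have hp := h.b_pos w hw0
  have hmem : g ((√(b w w))⁻¹ • w) ((√(b w w))⁻¹ • w) ∈ A :=
    ⟨_, hnorm w hw0, fun f hf => by simp [hw f hf], rfl⟩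
  have := hle.trans (csInf_le hAb hmem)
  simp only [map_smul, LinearMap.smul_apply, smul_eq_mul] at this
  rw [← mul_assoc, ← mul_inv, Real.mul_self_sqrt hp.le, inv_mul_eq_div, le_div_iff₀ hp] at this
  exact this

/-- A constrained minimizer is an eigenvector, as soon as the constraints are orthogonality to
finitely many orthonormal eigenvectors. -/
lemma exists_eigenvector (h : IsCompactPair b g θ) (hH : ¬ FiniteDimensional ℝ H) (S : Set H)
    (hfin : S.Finite) (hS1 : ∀ f ∈ S, b f f = 1)
    (hSo : ∀ f ∈ S, ∀ f' ∈ S, f ≠ f' → b f f' = 0)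
    (hSe : ∀ f ∈ S, ∀ v, g f v = g f f * b f v) :
    ∃ e, b e e = 1 ∧ (∀ f ∈ S, b f e = 0) ∧ (∀ v, g e v = g e e * b e v) ∧
      ∀ w, (∀ f ∈ S, b f w = 0) → g e e * b w w ≤ g w w := by
  classical
  -- the orthogonal projection on the complement of `S`
  let P : H → H := fun v => v - ∑ f ∈ hfin.toFinset, b f v • f
  have hP : ∀ v, ∀ f ∈ S, b f (P v) = 0 := by
    intro v f hf
    simp only [P, map_sub, map_sum, map_smul, smul_eq_mul]
    rw [Finset.sum_eq_single_of_mem f (by simpa using hf)]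
    · rw [hS1 f hf]; ring
    · intro f' hf' hne
      rw [hSo f hf f' (by simpa using hf') hne.symm, mul_zero]
  have hne : ∃ w, w ≠ 0 ∧ ∀ f ∈ S, b f w = 0 := by
    by_contra! hcon
    apply hH
    have : Submodule.span ℝ S = ⊤ := by
      rw [eq_top_iff]
      intro v _
      by_cases hv : P v = 0
      · rw [sub_eq_zero.1 hv]
        exact Submodule.sum_mem _ fun f hf => Submodule.smul_mem _ _
          (Submodule.subset_span (by simpa using hf))
      · obtain ⟨f, hf, hf'⟩ := hcon _ hv
        exact absurd (hP v f hf) hf'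
    exact ⟨hfin.toFinset, by simpa using this⟩
  obtain ⟨e, he1, heS, hmin⟩ := h.exists_min S hne
  refine ⟨e, he1, heS, fun v => ?_, hmin⟩
  -- Euler–Lagrange equation tested with vectors of the complement
  have hEL : ∀ w, (∀ f ∈ S, b f w = 0) → g e w = g e e * b e w := by
    intro w hw
    have hq : ∀ t : ℝ, 0 ≤ (g w w - g e e * b w w) * (t * t)
        + (2 * (g e w - g e e * b e w)) * t + 0 := by
      intro t
      have := hmin (e + t • w) (fun f hf => by simp [heS f hf, hw f hf])
      simp only [map_add, LinearMap.add_apply, map_smul, LinearMap.smul_apply, smul_eq_mul,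
        h.b_symm w e, h.g_symm w e, he1] at this
      nlinarith
    have := discrim_le_zero hq
    rw [discrim] at this
    have h0 : (2 * (g e w - g e e * b e w)) ^ 2 = 0 :=
      le_antisymm (by linarith) (sq_nonneg _)
    have := pow_eq_zero_iff (two_ne_zero) |>.1 h0
    linarith
  have hv : v = P v + ∑ f ∈ hfin.toFinset, b f v • f := by simp [P]
  rw [hv, map_add, map_add, mul_add, hEL _ (hP v)]
  congr 1
  simp only [map_sum, map_smul, smul_eq_mul, Finset.mul_sum]
  refine Finset.sum_congr rfl fun f hf => ?_
  have hf' : f ∈ S := by simpa using hf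
  rw [h.g_symm, hSe f hf', h.b_symm e f, heS f hf']
  ring

/-- The spectral theorem for a compact pair. -/
theorem exists_eigenbasis (h : IsCompactPair b g θ) (hH : ¬ FiniteDimensional ℝ H) :
    ∃ e : ℕ → H, (∀ i j, b (e i) (e j) = if i = j then 1 else 0) ∧
      (∀ i v, g (e i) v = g (e i) (e i) * b (e i) v) ∧
      (∀ n w, (∀ i < n, b (e i) w = 0) → g (e n) (e n) * b w w ≤ g w w) ∧
      Monotone (fun n => g (e n) (e n)) ∧ Tendsto (fun n => g (e n) (e n)) atTop atTop := by
  classical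
  have key := h.exists_eigenvector hH
  choose! next hn1 hno hne hnm using key
  let E : ℕ → Set H := fun n => Nat.rec ∅ (fun _ S => insert (next S) S) n
  let e : ℕ → H := fun n => next (E n)
  have hE : ∀ n, E n = e '' Set.Iio n := by
    intro n
    induction n with
    | zero => simp [E]
    | succ n ih =>
      change insert (next (E n)) (E n) = _
      have hI : Set.Iio (n + 1) = insert n (Set.Iio n) := by
        ext i
        simp only [Set.mem_Iio, Set.mem_insert_iff]
        omega
      rw [hI, Set.image_insert_eq, ← ih]
  have hgood : ∀ n, (E n).Finite ∧ (∀ f ∈ E n, b f f = 1) ∧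
      (∀ f ∈ E n, ∀ f' ∈ E n, f ≠ f' → b f f' = 0) ∧ (∀ f ∈ E n, ∀ v, g f v = g f f * b f v) := by
    intro n
    induction n with
    | zero => simp [E]
    | succ n ih =>
      obtain ⟨i1, i2, i3, i4⟩ := ih
      have hEs : E (n + 1) = insert (next (E n)) (E n) := rfl
      rw [hEs]
      have o := hno _ i1 i2 i3 i4
      refine ⟨i1.insert _, ?_, ?_, ?_⟩
      · rintro f (rfl | hf)
        · exact hn1 _ i1 i2 i3 i4
        · exact i2 f hf
      · rintro f (rfl | hf) f' (rfl | hf') hff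
        · exact absurd rfl hff
        · rw [h.b_symm]; exact o f' hf'
        · exact o f hf
        · exact i3 f hf f' hf' hff
      · rintro f (rfl | hf)
        · exact hne _ i1 i2 i3 i4
        · exact i4 f hf
  have e1 : ∀ n, b (e n) (e n) = 1 := fun n =>
    hn1 _ (hgood n).1 (hgood n).2.1 (hgood n).2.2.1 (hgood n).2.2.2
  have eo : ∀ i n, i < n → b (e i) (e n) = 0 := fun i n hi =>
    hno _ (hgood n).1 (hgood n).2.1 (hgood n).2.2.1 (hgood n).2.2.2 _
      (by rw [hE]; exact ⟨i, hi, rfl⟩)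
  have ee : ∀ n v, g (e n) v = g (e n) (e n) * b (e n) v := fun n =>
    hne _ (hgood n).1 (hgood n).2.1 (hgood n).2.2.1 (hgood n).2.2.2
  have em : ∀ n w, (∀ i < n, b (e i) w = 0) → g (e n) (e n) * b w w ≤ g w w := fun n w hw =>
    hnm _ (hgood n).1 (hgood n).2.1 (hgood n).2.2.1 (hgood n).2.2.2 w (by
      rw [hE]; rintro _ ⟨i, hi, rfl⟩; exact hw i hi)
  have eoo : ∀ i j, b (e i) (e j) = if i = j then 1 else 0 := by
    intro i j
    rcases lt_trichotomy i j with hij | rfl | hij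
    · rw [eo i j hij, if_neg hij.ne]
    · rw [e1, if_pos rfl]
    · rw [h.b_symm, eo j i hij, if_neg hij.ne']
  have hmono : Monotone (fun n => g (e n) (e n)) := by
    refine monotone_nat_of_le_succ fun n => ?_
    have := em n (e (n + 1)) (fun i hi => eo i (n + 1) (Nat.lt_succ_of_lt hi))
    rwa [e1 (n + 1), mul_one] at this
  refine ⟨e, eoo, ee, em, hmono, ?_⟩
  rcases tendsto_atTop_of_monotone hmono with ht | ⟨l, hl⟩
  · exact ht
  -- a bounded sequence of eigenvalues contradicts compactness
  exfalso
  obtain ⟨u, s, hs, hu, -⟩ := h.compact e ⟨l + θ, fun n => by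
    rw [e1, mul_one]
    exact add_le_add_left (hmono.ge_of_tendsto hl n) θ⟩
  have hbu : Tendsto (fun n => b (e (s n)) (e (s n))) atTop (𝓝 (b u u)) := h.tendsto_b_self hu
  simp only [e1] at hbu
  have hu1 : b u u = 1 := (tendsto_nhds_unique hbu tendsto_const_nhds)
  have hz : ∀ i, b (e i) u = 0 := by
    intro i
    refine tendsto_nhds_unique (h.tendsto_b hu (e i)) ?_
    refine tendsto_const_nhds.congr' ?_
    filter_upwards [eventually_gt_atTop i] with n hn
    rw [eo _ _ (hn.trans_le (hs.id_le n))]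
  have h3 : Tendsto (fun n => b u (e (s n))) atTop (𝓝 1) := hu1 ▸ h.tendsto_b hu u
  simp only [h.b_symm u, hz] at h3
  exact one_ne_zero (tendsto_nhds_unique h3 tendsto_const_nhds)

end IsCompactPair

lemma exists_bound_inner {E : Type*} [NormedAddCommGroup E] [InnerProductSpace ℝ E]
    [FiniteDimensional ℝ E] (g : LinearMap.BilinForm ℝ E) :
    ∃ C : ℝ, ∀ u, g u u ≤ C * inner ℝ u u := by
  refine ⟨‖LinearMap.toContinuousBilinearMap g‖, fun u => ?_⟩
  have h1 := (LinearMap.toContinuousBilinearMap g).le_opNorm₂ u u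
  rw [real_inner_self_eq_norm_mul_norm u, ← mul_assoc]
  exact (le_abs_self _).trans h1

/-- On a finite-dimensional space a quadratic form is bounded by any positive definite one. -/
lemma exists_bound_of_finiteDimensional {E : Type*} [AddCommGroup E] [Module ℝ E]
    [FiniteDimensional ℝ E] (b g : LinearMap.BilinForm ℝ E) (hb : ∀ u v, b u v = b v u)
    (hpos : ∀ u, u ≠ 0 → 0 < b u u) : ∃ C : ℝ, ∀ u, g u u ≤ C * b u u := by
  let core : InnerProductSpace.Core ℝ E :=
    { inner := fun u v => b u v
      conj_inner_symm := fun u v => hb v u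
      re_inner_nonneg := fun u => by
        by_cases hu : u = 0
        · simp [hu]
        · exact (hpos u hu).le
      add_left := fun u v w => by simp
      smul_left := fun u v r => by simp
      definite := fun u hu => by
        by_contra hne
        exact (hpos u hne).ne' hu }
  exact @exists_bound_inner E core.toNormedAddCommGroup (InnerProductSpace.ofCore core.toCore) _ g

/-! ### Eigenbases and the min-max formula for Rayleigh families -/

namespace RayleighFamily

section Forms

variable {X Y : Type*} [AddCommGroup Y] [Module ℝ Y] (R : RayleighFamily X Y)

/-- `B(x, ·, ·)` as a bilinear map on `Y`. -/
noncomputable def Bform (x : X) : LinearMap.BilinForm ℝ Y := QuadraticMap.associated (R.Q x)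

/-- `Γ(x, ·, ·)` as a bilinear map on `H x`. -/
noncomputable def Gform (x : X) : LinearMap.BilinForm ℝ (R.H x) := QuadraticMap.associated (R.G x)

lemma B_eq (x : X) (u v : Y) : R.B x u v = R.Bform x u v := by
  simp [B, Bform, QuadraticMap.associated_apply, div_eq_inv_mul]

lemma Gval_coe (x : X) (u : R.H x) : R.Gval x u = R.G x u := by
  simp [Gval]

lemma Gam_coe (x : X) (u v : R.H x) : R.Gam x u v = R.Gform x u v := by
  have : R.Gval x ((u : Y) + v) = R.G x (u + v) := R.Gval_coe x (u + v)
  rw [Gam, this, Gval_coe, Gval_coe, Gform, QuadraticMap.associated_apply]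
  simp [div_eq_inv_mul]

lemma B_self (x : X) (u : Y) : R.B x u u = R.Q x u := by
  rw [B, ← two_smul ℝ u, QuadraticMap.map_smul, smul_eq_mul]
  ring

lemma B_comm (x : X) (u v : Y) : R.B x u v = R.B x v u := by
  rw [B, B, add_comm u v]; ring

lemma Gval_smul (x : X) (c : ℝ) (u : Y) : R.Gval x (c • u) = c ^ 2 * R.Gval x u := by
  by_cases hc : c = 0
  · have h0 : R.Gval x (0 : Y) = 0 := by
      have := R.Gval_coe x 0
      simpa using this
    simp [hc, h0]
  by_cases hu : u ∈ R.H x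
  · have h1 : R.Gval x (c • u) = R.G x (c • ⟨u, hu⟩) := R.Gval_coe x (c • ⟨u, hu⟩)
    have h2 : R.Gval x u = R.G x ⟨u, hu⟩ := R.Gval_coe x ⟨u, hu⟩
    rw [h1, h2, QuadraticMap.map_smul, smul_eq_mul]; ring
  · have hcu : c • u ∉ R.H x := fun h => hu (((R.H x).smul_mem_iff hc).1 h)
    simp [Gval, hu, hcu]

lemma Gam_self (x : X) (u : Y) : R.Gam x u u = R.Gval x u := by
  rw [Gam, ← two_smul ℝ u, Gval_smul]
  ring

lemma Gam_comm (x : X) (u v : Y) : R.Gam x u v = R.Gam x v u := by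
  rw [Gam, Gam, add_comm u v]; ring

lemma Q_sub (x : X) (u v : Y) : R.Q x (u - v) = R.Q x u - 2 * R.B x u v + R.Q x v := by
  simp only [← B_self, B_eq, map_sub, LinearMap.sub_apply]
  rw [← B_eq R x v u, B_comm, B_eq]
  ring

lemma Q_smul (x : X) (c : ℝ) (u : Y) : R.Q x (c • u) = c ^ 2 * R.Q x u := by
  rw [QuadraticMap.map_smul, smul_eq_mul]; ring

lemma Gam_add_left (x : X) {u v w : Y} (hu : u ∈ R.H x) (hv : v ∈ R.H x) (hw : w ∈ R.H x) :
    R.Gam x (u + v) w = R.Gam x u w + R.Gam x v w := by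
  lift u to R.H x using hu
  lift v to R.H x using hv
  lift w to R.H x using hw
  rw [← Submodule.coe_add, Gam_coe, Gam_coe, Gam_coe, map_add, LinearMap.add_apply]

lemma Gam_smul_left (x : X) (c : ℝ) {u w : Y} (hu : u ∈ R.H x) (hw : w ∈ R.H x) :
    R.Gam x (c • u) w = c * R.Gam x u w := by
  lift u to R.H x using hu
  lift w to R.H x using hw
  rw [← Submodule.coe_smul, Gam_coe, Gam_coe, map_smul, LinearMap.smul_apply, smul_eq_mul]

lemma Gam_sub_left (x : X) {u v w : Y} (hu : u ∈ R.H x) (hv : v ∈ R.H x) (hw : w ∈ R.H x) :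
    R.Gam x (u - v) w = R.Gam x u w - R.Gam x v w := by
  rw [sub_eq_add_neg, ← neg_one_smul ℝ v, R.Gam_add_left x hu ((R.H x).smul_mem _ hv) hw,
    R.Gam_smul_left x _ hv hw]
  ring

lemma Gval_sub (x : X) {u v : Y} (hu : u ∈ R.H x) (hv : v ∈ R.H x) :
    R.Gval x (u - v) = R.Gval x u - 2 * R.Gam x u v + R.Gval x v := by
  have huv := (R.H x).sub_mem hu hv
  rw [← Gam_self, R.Gam_sub_left x hu hv huv, Gam_comm, R.Gam_sub_left x hu hv hu,
    Gam_comm R x v (u - v), R.Gam_sub_left x hu hv hv, Gam_self, Gam_self, Gam_comm R x v u]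
  ring

/-- `e 0, e 1, …` is a `Q x`-orthonormal sequence of eigenvectors for the eigenvalues
`λ_1(x) ≤ λ_2(x) ≤ …`, and each eigenvalue is the minimum of the Rayleigh quotient on the
orthogonal complement of the preceding eigenvectors. -/
structure IsEigenbasis (x : X) (e : ℕ → Y) : Prop where
  mem : ∀ n, e n ∈ R.H x
  orth : ∀ i j, R.B x (e i) (e j) = if i = j then 1 else 0
  eigen : ∀ n, ∀ v ∈ R.H x, R.Gam x (e n) v = R.lam (n + 1) x * R.B x (e n) v
  le : ∀ n, ∀ w ∈ R.H x, (∀ i < n, R.B x (e i) w = 0) → R.lam (n + 1) x * R.Q x w ≤ R.Gval x w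
  mono : Monotone fun n => R.lam (n + 1) x
  tendsto : Tendsto (fun n => R.lam (n + 1) x) atTop atTop

lemma mem_eigenspace {k : ℕ} {x : X} {u : Y} : u ∈ R.eigenspace k x ↔
    u ∈ R.H x ∧ ∀ v ∈ R.H x, R.Gam x u v = R.lam k x * R.B x u v := by
  simp only [eigenspace, Set.mem_ofPred_eq, B_eq, map_smul, LinearMap.smul_apply, smul_eq_mul]

/-- A subspace of dimension `n + 1` meets the orthogonal complement of `n` vectors. -/
lemma exists_ne_zero_orthogonal (x : X) (e : ℕ → Y) (n : ℕ) (E : Submodule ℝ Y)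
    (hE : Module.finrank ℝ E = n + 1) :
    ∃ u ∈ E, u ≠ 0 ∧ ∀ i < n, R.B x (e i) u = 0 := by
  have : FiniteDimensional ℝ E := Module.finite_of_finrank_pos (by omega)
  let f : E →ₗ[ℝ] (Fin n → ℝ) := LinearMap.pi fun i => (R.Bform x (e i)).comp E.subtype
  have hf : f.ker ≠ ⊥ := LinearMap.ker_ne_bot_of_finrank_lt (by simp [hE])
  obtain ⟨u, hu, hu0⟩ := Submodule.exists_mem_ne_zero_of_ne_bot hf
  refine ⟨u, u.2, by simpa using hu0, fun i hi => ?_⟩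
  have := congrFun (LinearMap.mem_ker.1 hu) ⟨i, hi⟩
  rw [B_eq]
  exact this

lemma finrank_span_orthonormal (x : X) (e : ℕ → Y)
    (ho : ∀ i j, R.B x (e i) (e j) = if i = j then 1 else 0) (n : ℕ) :
    Module.finrank ℝ (Submodule.span ℝ (Set.range fun i : Fin n => e i)) = n := by
  have hli : LinearIndependent ℝ (fun i : Fin n => e i) := by
    rw [Fintype.linearIndependent_iff]
    intro c hc i
    have h1 : R.Bform x (e i) (∑ j : Fin n, c j • e j) = 0 := by rw [hc, map_zero]
    simp only [map_sum, map_smul, smul_eq_mul, ← B_eq, ho] at h1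
    simpa [← Fin.ext_iff] using h1
  simpa using finrank_span_eq_card hli

/-- On the span of the first `n + 1` eigenvectors, the Rayleigh quotient is at most `m n`. -/
lemma mem_span_le {x : X} {e : ℕ → Y} {m : ℕ → ℝ} (hm : Monotone m) (hmem : ∀ n, e n ∈ R.H x)
    (ho : ∀ i j, R.B x (e i) (e j) = if i = j then 1 else 0)
    (he : ∀ n, ∀ v ∈ R.H x, R.Gam x (e n) v = m n * R.B x (e n) v) (n : ℕ) {u : Y}
    (hu : u ∈ Submodule.span ℝ (Set.range fun i : Fin (n + 1) => e i)) :
    u ∈ R.H x ∧ R.Gval x u ≤ m n * R.Q x u := by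
  obtain ⟨c, rfl⟩ := (Submodule.mem_span_range_iff_exists_fun ℝ).1 hu
  have hH : ∑ i : Fin (n + 1), c i • e i ∈ R.H x :=
    Submodule.sum_mem _ fun i _ => Submodule.smul_mem _ _ (hmem i)
  refine ⟨hH, ?_⟩
  set w := ∑ i : Fin (n + 1), c i • e i with hw
  have hBe : ∀ i : Fin (n + 1), R.B x (e i) w = c i := by
    intro i
    simp only [hw, B_eq, map_sum, map_smul, smul_eq_mul]
    simp [← B_eq, ho, ← Fin.ext_iff]
  have hQ : R.Q x w = ∑ i : Fin (n + 1), c i ^ 2 := by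
    rw [← B_self]
    calc R.B x w w = ∑ i : Fin (n + 1), c i * R.B x w (e i) := by
          conv_lhs => arg 4; rw [hw]
          simp only [B_eq, map_sum, map_smul, smul_eq_mul]
      _ = _ := Finset.sum_congr rfl fun i _ => by rw [R.B_comm, hBe, sq]
  have hG : R.Gval x w = ∑ i : Fin (n + 1), m i * c i ^ 2 := by
    have hGe : ∀ v ∈ R.H x, R.Gam x w v = ∑ i : Fin (n + 1), c i * R.Gam x (e i) v := by
      intro v hv
      have : (⟨w, hH⟩ : R.H x) = ∑ i : Fin (n + 1), c i • (⟨e i, hmem i⟩ : R.H x) := by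
        ext; simp [hw]
      rw [R.Gam_coe x ⟨w, hH⟩ ⟨v, hv⟩, this, map_sum, LinearMap.sum_apply]
      refine Finset.sum_congr rfl fun i _ => ?_
      rw [map_smul, LinearMap.smul_apply, smul_eq_mul, R.Gam_coe x ⟨e i, hmem i⟩ ⟨v, hv⟩]
    rw [← Gam_self, hGe w hH]
    refine Finset.sum_congr rfl fun i _ => ?_
    rw [he _ w hH, hBe]; ring
  rw [hQ, hG, Finset.mul_sum]
  refine Finset.sum_le_sum fun i _ => mul_le_mul_of_nonneg_right (hm (by omega)) (sq_nonneg _)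

/-- The min-max formula gives the eigenvalues found by successive minimization. -/
lemma lam_eq {x : X} (hQ : (R.Q x).PosDef) {e : ℕ → Y} {m : ℕ → ℝ} (hm : Monotone m)
    (hmem : ∀ n, e n ∈ R.H x) (ho : ∀ i j, R.B x (e i) (e j) = if i = j then 1 else 0)
    (he : ∀ n, ∀ v ∈ R.H x, R.Gam x (e n) v = m n * R.B x (e n) v)
    (hle : ∀ n, ∀ w ∈ R.H x, (∀ i < n, R.B x (e i) w = 0) → m n * R.Q x w ≤ R.Gval x w) (n : ℕ) :
    R.lam (n + 1) x = m n := by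
  have hlow : ∀ a ∈ {a : ℝ | ∃ E : Submodule ℝ Y, E ≤ R.H x ∧ Module.finrank ℝ E = n + 1 ∧
      a = sSup (R.rayleigh x '' {u : Y | u ∈ E ∧ R.Q x u = 1})}, m n ≤ a := by
    rintro a ⟨E, hEH, hEn, rfl⟩
    have : FiniteDimensional ℝ E := Module.finite_of_finrank_pos (by omega)
    obtain ⟨u, huE, hu0, huo⟩ := R.exists_ne_zero_orthogonal x e n E hEn
    have hp : 0 < R.Q x u := hQ u hu0
    -- the Rayleigh quotient is bounded on the unit sphere, so that `sSup` is a supremum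
    obtain ⟨C, hC⟩ := exists_bound_of_finiteDimensional
      ((R.Bform x).domRestrict₁₂ E E)
      ((R.Gform x).compl₁₂ (Submodule.inclusion hEH) (Submodule.inclusion hEH))
      (fun u v => by
        simp only [LinearMap.domRestrict₁₂_apply, ← B_eq]
        exact R.B_comm _ _ _)
      (fun u hu => by
        simp only [LinearMap.domRestrict₁₂_apply, ← B_eq, B_self]
        exact hQ _ (by simpa using hu))
    have hbdd : BddAbove (R.rayleigh x '' {u : Y | u ∈ E ∧ R.Q x u = 1}) := by
      refine ⟨C, ?_⟩
      rintro _ ⟨v, ⟨hvE, hv1⟩, rfl⟩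
      have h1 := hC ⟨v, hvE⟩
      simp only [LinearMap.domRestrict₁₂_apply, ← B_eq, B_self, LinearMap.compl₁₂_apply,
        ← Gam_coe, Gam_self, Submodule.coe_inclusion] at h1
      rw [rayleigh, hv1, div_one]
      rwa [hv1, mul_one] at h1
    set c := (√(R.Q x u))⁻¹ with hc
    have hc2 : c ^ 2 * R.Q x u = 1 := by
      rw [hc, inv_pow, Real.sq_sqrt hp.le, inv_mul_cancel₀ hp.ne']
    refine le_trans ?_ (le_csSup hbdd ⟨c • u, ⟨E.smul_mem _ huE, by rw [Q_smul, hc2]⟩, rfl⟩)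
    rw [rayleigh, Q_smul, hc2, div_one, Gval_smul]
    have := hle n u (hEH huE) huo
    calc m n = c ^ 2 * (m n * R.Q x u) := by rw [mul_left_comm, hc2, mul_one]
      _ ≤ _ := mul_le_mul_of_nonneg_left this (sq_nonneg c)
  refine le_antisymm ?_ (le_csInf ?_ hlow)
  · have hmemS := fun u hu => R.mem_span_le hm hmem ho he n (u := u) hu
    refine (csInf_le ⟨m n, hlow⟩
      ⟨Submodule.span ℝ (Set.range fun i : Fin (n + 1) => e i), fun u hu => (hmemS u hu).1,
        R.finrank_span_orthonormal x e ho (n + 1), rfl⟩).trans (csSup_le ?_ ?_)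
    · refine ⟨_, e 0, ⟨Submodule.subset_span ⟨0, rfl⟩, ?_⟩, rfl⟩
      rw [← B_self, ho, if_pos rfl]
    · rintro _ ⟨v, ⟨hvE, hv1⟩, rfl⟩
      have := (hmemS v hvE).2
      rw [hv1, mul_one] at this
      rwa [rayleigh, hv1, div_one]
  · exact ⟨_, Submodule.span ℝ (Set.range fun i : Fin (n + 1) => e i),
      fun u hu => (R.mem_span_le hm hmem ho he n hu).1, R.finrank_span_orthonormal x e ho (n + 1),
      rfl⟩

end Forms

section Spectral

variable {X Y : Type*} [NormedAddCommGroup X] [NormedSpace ℝ X] [AddCommGroup Y] [Module ℝ Y]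
  {R : RayleighFamily X Y} {Ω : Set X}

lemma StandingAssumptions.not_finiteDimensional_H (hR : R.StandingAssumptions Ω)
    (hY : ¬ FiniteDimensional ℝ Y) {x : X} (hx : x ∈ Ω) : ¬ FiniteDimensional ℝ (R.H x) := by
  intro hfin
  have hpos := hR.Q_posDef x hx
  -- a finite-dimensional dense subspace is everything
  have htop : R.H x = ⊤ := by
    rw [eq_top_iff]
    intro y _
    have hnd : ((R.Bform x).restrict (R.H x)).Nondegenerate := by
      refine LinearMap.BilinForm.nondegenerate_restrict_of_disjoint_orthogonal _ ?_ ?_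
      · intro u v huv
        rwa [← B_eq, B_comm, B_eq]
      · rw [Submodule.disjoint_def]
        intro u hu hu'
        by_contra h0
        have h1 : R.Bform x u u = 0 := hu' u hu
        have h2 := hpos u h0
        rw [← B_eq, B_self] at h1
        linarith
    obtain ⟨p, hp, w, hw, rfl⟩ : ∃ p ∈ R.H x, ∃ w, (∀ u ∈ R.H x, R.B x u w = 0) ∧ p + w = y := by
      set p := (((R.Bform x).restrict (R.H x)).toDual hnd).symm ((R.Bform x y).comp (R.H x).subtype)
        with hp
      refine ⟨p, p.2, y - p, fun u hu => ?_, by abel⟩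
      have h1 : R.Bform x p u = R.Bform x y u :=
        LinearMap.BilinForm.apply_toDual_symm_apply
          (B := (R.Bform x).restrict (R.H x)) (hB := hnd) _ ⟨u, hu⟩
      rw [B_comm, B_eq, map_sub, LinearMap.sub_apply, h1, sub_self]
    have hw0 : w = 0 := by
      by_contra h0
      obtain ⟨u, hu, hlt⟩ := hR.H_dense x hx (p + w) _ (hpos w h0)
      have h1 : R.B x (p - u) w = 0 := by
        exact hw _ (Submodule.sub_mem _ hp hu)
      have h2 : R.Q x (p + w - u) = R.Q x (p - u) + R.Q x w := by
        have : R.Q x (p - u + w) - R.Q x (p - u) - R.Q x w = 0 := by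
          rw [B] at h1
          linarith
        rw [show p + w - u = p - u + w by abel]
        linarith
      have h3 := hpos.nonneg (p - u)
      linarith
    rw [hw0, add_zero]
    exact hp
  apply hY
  rw [htop] at hfin
  exact (Submodule.topEquiv (R := ℝ) (M := Y)).finiteDimensional

lemma LocalAssumptions.gval_nonneg {V : Set X} {θ : X → ℝ} {x : X} (h : R.LocalAssumptions V θ x)
    {y : X} (hy : y ∈ V) {u : Y} (hu : u ∈ R.H y) : 0 ≤ R.Gval y u + θ y * R.Q y u := by
  by_cases hu0 : u = 0
  · have := R.Gval_smul y 0 0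
    simp only [smul_zero] at this
    rw [hu0, this]
    simp
  · exact (h.nrm_posDef y hy u hu hu0).le

/-- Every point of `Ω` admits an eigenbasis. -/
theorem StandingAssumptions.exists_isEigenbasis (hR : R.StandingAssumptions Ω)
    (hY : ¬ FiniteDimensional ℝ Y) {x : X} (hx : x ∈ Ω) : ∃ e, R.IsEigenbasis x e := by
  obtain ⟨V, hV, -, θ, hloc⟩ := hR.loc x hx
  have hxV := mem_of_mem_nhds hV
  have hpair : IsCompactPair ((R.Bform x).domRestrict₁₂ (R.H x) (R.H x)) (R.Gform x) (θ x) := by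
    refine ⟨fun u v => ?_, fun u v => ?_, fun u hu => ?_, fun u => ?_, fun us hus => ?_⟩
    · simp only [LinearMap.domRestrict₁₂_apply, ← B_eq]
      exact R.B_comm _ _ _
    · rw [← Gam_coe, Gam_comm, Gam_coe]
    · simp only [LinearMap.domRestrict₁₂_apply, ← B_eq, B_self]
      exact hR.Q_posDef x hx _ (by simpa using hu)
    · simp only [LinearMap.domRestrict₁₂_apply, ← B_eq, ← Gam_coe, B_self, Gam_self]
      exact hloc.gval_nonneg hxV u.2
    · obtain ⟨M, hM⟩ := hus
      obtain ⟨u, hu, s, hs, h1, h2⟩ := hloc.compactness (fun _ => x) (fun n => us n)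
        (fun _ => hxV) tendsto_const_nhds (fun n => (us n).2) ⟨√M, fun n => by
          have := hM n
          simp only [LinearMap.domRestrict₁₂_apply, ← B_eq, ← Gam_coe, B_self, Gam_self] at this
          exact Real.sqrt_le_sqrt this⟩
      refine ⟨⟨u, hu⟩, s, hs, ?_, fun h => ?_⟩
      · simp only [LinearMap.domRestrict₁₂_apply, ← B_eq, B_self]
        exact h1
      · simp only [← Gam_coe]
        exact h2 h h.2
  obtain ⟨e, ho, he, hle, hm, ht⟩ := hpair.exists_eigenbasis (hR.not_finiteDimensional_H hY hx)
  simp only [LinearMap.domRestrict₁₂_apply, ← B_eq, B_self] at ho he hle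
  have he' : ∀ n, ∀ v ∈ R.H x,
      R.Gam x (e n) v = R.Gform x (e n) (e n) * R.B x (e n) v := by
    intro n v hv
    rw [← he n ⟨v, hv⟩, ← Gam_coe]
  have hle' : ∀ n, ∀ w ∈ R.H x, (∀ i < n, R.B x (e i) w = 0) →
      R.Gform x (e n) (e n) * R.Q x w ≤ R.Gval x w := by
    intro n w hw hi
    have := hle n ⟨w, hw⟩ hi
    rwa [← Gam_coe R x ⟨w, hw⟩, Gam_self] at this
  have hlam := R.lam_eq (hR.Q_posDef x hx) hm (fun n => (e n).2) ho he' hle'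
  refine ⟨fun n => e n, fun n => (e n).2, ho, ?_, ?_, ?_, ?_⟩ <;> simpa only [hlam]

end Spectral

namespace IsEigenbasis

variable {X Y : Type*} [AddCommGroup Y] [Module ℝ Y] {R : RayleighFamily X Y} {x : X} {e : ℕ → Y}

lemma Q_eq_one (h : R.IsEigenbasis x e) (n : ℕ) : R.Q x (e n) = 1 := by
  rw [← B_self, h.orth, if_pos rfl]

lemma mem_eigenspace (h : R.IsEigenbasis x e) (n : ℕ) : e n ∈ R.eigenspace (n + 1) x :=
  R.mem_eigenspace.2 ⟨h.mem n, h.eigen n⟩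

/-- The index `0` is excluded because `λ_0` has no meaning. -/
lemma lam_mono (h : R.IsEigenbasis x e) {j k : ℕ} (hj : 1 ≤ j) (hjk : j ≤ k) :
    R.lam j x ≤ R.lam k x := by
  obtain ⟨j, rfl⟩ := Nat.exists_eq_add_of_le' hj
  obtain ⟨k, rfl⟩ := Nat.exists_eq_add_of_le' (hj.trans hjk)
  exact h.mono (by omega)

/-- Upper bounds for `λ_{n+1}` from trial subspaces. -/
lemma lam_le (h : R.IsEigenbasis x e) (hQ : (R.Q x).PosDef) {n : ℕ} {E : Submodule ℝ Y}
    (hEH : E ≤ R.H x) (hE : Module.finrank ℝ E = n + 1) {a : ℝ}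
    (ha : ∀ u ∈ E, R.Gval x u ≤ a * R.Q x u) : R.lam (n + 1) x ≤ a := by
  obtain ⟨u, hu, hu0, huo⟩ := R.exists_ne_zero_orthogonal x e n E hE
  have h1 := h.le n u (hEH hu) huo
  exact le_of_mul_le_mul_right (h1.trans (ha u hu)) (hQ u hu0)

/-- An optimal trial subspace for `λ_{n+1}`. -/
lemma exists_subspace (h : R.IsEigenbasis x e) (n : ℕ) : ∃ E : Submodule ℝ Y, E ≤ R.H x ∧
    Module.finrank ℝ E = n + 1 ∧ ∀ u ∈ E, R.Gval x u ≤ R.lam (n + 1) x * R.Q x u :=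
  ⟨Submodule.span ℝ (Set.range fun i : Fin (n + 1) => e i),
    fun _ hu => (R.mem_span_le h.mono h.mem h.orth h.eigen n hu).1,
    R.finrank_span_orthonormal x e h.orth (n + 1),
    fun _ hu => (R.mem_span_le h.mono h.mem h.orth h.eigen n hu).2⟩

lemma orthonormalFamily (h : R.IsEigenbasis x e) (n : ℕ) :
    R.OrthonormalFamily x n (fun k => e (k - 1)) := by
  refine ⟨⟨fun k hk => ?_, fun k hk l hl hkl => ?_⟩, fun k hk => h.Q_eq_one _⟩
  · have := h.mem_eigenspace (k - 1)
    rwa [Nat.sub_add_cancel (Finset.mem_Icc.1 hk).1] at this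
  · rw [h.orth, if_neg]
    have := (Finset.mem_Icc.1 hk).1
    have := (Finset.mem_Icc.1 hl).1
    omega

/-- Eigenvectors are combinations of the basis vectors with the same eigenvalue. -/
lemma eq_sum (h : R.IsEigenbasis x e) (hQ : (R.Q x).PosDef) {k : ℕ} {u : Y}
    (hu : u ∈ R.eigenspace k x) {s : Finset ℕ} (hs : ∀ n, n ∈ s ↔ R.lam (n + 1) x = R.lam k x) :
    u = ∑ n ∈ s, R.B x u (e n) • e n := by
  obtain ⟨huH, hue⟩ := R.mem_eigenspace.1 hu
  set w := u - ∑ n ∈ s, R.B x u (e n) • e n with hw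
  have hwH : w ∈ R.H x :=
    Submodule.sub_mem _ huH (Submodule.sum_mem _ fun n _ => Submodule.smul_mem _ _ (h.mem n))
  have hBw : ∀ i, R.B x (e i) w = R.B x (e i) u - ∑ n ∈ s, R.B x u (e n) * R.B x (e i) (e n) := by
    intro i
    simp only [hw, B_eq, map_sub, map_sum, map_smul, smul_eq_mul]
  have ho : ∀ i, R.B x (e i) w = 0 := by
    intro i
    rw [hBw]
    simp only [h.orth, mul_ite, mul_one, mul_zero, Finset.sum_ite_eq]
    split_ifs with his
    · rw [R.B_comm, sub_self]
    · have h1 := h.eigen i u huH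
      have h2 := hue (e i) (h.mem i)
      rw [Gam_comm, h2, R.B_comm] at h1
      have h3 : (R.lam k x - R.lam (i + 1) x) * R.B x (e i) u = 0 := by linarith
      rcases mul_eq_zero.1 h3 with h4 | h4
      · exact absurd ((hs i).2 (by linarith)) his
      · rw [h4, sub_zero]
  by_contra hne
  have hw0 : w ≠ 0 := fun h0 => hne (sub_eq_zero.1 h0)
  have hp := hQ w hw0
  obtain ⟨n, hn⟩ := (h.tendsto.eventually_gt_atTop (R.Gval x w / R.Q x w)).exists
  have := h.le n w hwH fun i _ => ho i
  rw [div_lt_iff₀ hp] at hn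
  linarith

end IsEigenbasis

end RayleighFamily

/-! ### Continuity and first-order perturbation of eigenvalues and eigenvectors -/

namespace RayleighFamily

section Comparison

variable {X Y : Type*} [AddCommGroup Y] [Module ℝ Y] {R : RayleighFamily X Y}

lemma Q_add_le {x : X} (hQ : (R.Q x).PosDef) (u v : Y) :
    R.Q x (u + v) ≤ 2 * R.Q x u + 2 * R.Q x v := by
  have h1 := hQ.nonneg (u - v)
  have h2 : R.B x u v = (R.Q x (u + v) - R.Q x u - R.Q x v) / 2 := rfl
  rw [Q_sub] at h1
  linarith

/-- If the forms at `a` and `c` differ by at most `δ p`, where `p ≤ D Q` on an optimal trial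
subspace at `a`, then `λ_{n+1}(c)` cannot exceed `λ_{n+1}(a)` by more than `η`. -/
lemma lam_le_add {a c : X} {ea ec : ℕ → Y} (ha : R.IsEigenbasis a ea) (hc : R.IsEigenbasis c ec)
    (hQa : (R.Q a).PosDef) (hQc : (R.Q c).PosDef) (hH : R.H a = R.H c) (n : ℕ) {p : Y → ℝ}
    {δ D η : ℝ} (hδ : 0 ≤ δ)
    (hG : ∀ u ∈ R.H a, |R.Gval c u - R.Gval a u| ≤ δ * p u)
    (hQ : ∀ u ∈ R.H a, |R.Q c u - R.Q a u| ≤ δ * p u)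
    (hp : ∀ u ∈ R.H a, R.Gval a u ≤ R.lam (n + 1) a * R.Q a u → p u ≤ D * R.Q a u)
    (hη : δ * (1 + |R.lam (n + 1) a + η|) * D ≤ η) :
    R.lam (n + 1) c ≤ R.lam (n + 1) a + η := by
  obtain ⟨E, hEH, hE, hEl⟩ := ha.exists_subspace n
  refine hc.lam_le hQc (hEH.trans hH.le) hE fun u hu => ?_
  have h1 := (abs_le.1 (hG u (hEH hu))).2
  have h2 := hp u (hEH hu) (hEl u hu)
  have h3 := hEl u hu
  have hq := hQa.nonneg u
  set L := R.lam (n + 1) a + η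
  have h4 : -(|L| * (δ * p u)) ≤ L * (R.Q c u - R.Q a u) := by
    have := neg_abs_le (L * (R.Q c u - R.Q a u))
    rw [abs_mul] at this
    have := mul_le_mul_of_nonneg_left (hQ u (hEH hu)) (abs_nonneg L)
    linarith
  have h5 : δ * (1 + |L|) * p u ≤ η * R.Q a u := by
    calc δ * (1 + |L|) * p u ≤ δ * (1 + |L|) * (D * R.Q a u) :=
          mul_le_mul_of_nonneg_left h2 (by positivity)
      _ = δ * (1 + |L|) * D * R.Q a u := by ring
      _ ≤ _ := mul_le_mul_of_nonneg_right hη hq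
  have h6 : L * R.Q a u = R.lam (n + 1) a * R.Q a u + η * R.Q a u := by ring
  nlinarith

end Comparison

section Local

variable {X Y : Type*} [NormedAddCommGroup X] [NormedSpace ℝ X] [AddCommGroup Y] [Module ℝ Y]
  {R : RayleighFamily X Y} {Ω V : Set X} {θ : X → ℝ} {x : X}

lemma StandingAssumptions.differentiableAt_B (hR : R.StandingAssumptions Ω) {y : X} (hy : y ∈ Ω)
    (u v : Y) : DifferentiableAt ℝ (fun z => R.B z u v) y := by
  simp only [B, div_eq_mul_inv]
  exact (((hR.diff_Q y hy _).sub (hR.diff_Q y hy _)).sub (hR.diff_Q y hy _)).mul_const _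

lemma StandingAssumptions.differentiableAt_Gam (hR : R.StandingAssumptions Ω) {y : X} (hy : y ∈ Ω)
    {u v : Y} (hu : u ∈ R.H y) (hv : v ∈ R.H y) : DifferentiableAt ℝ (fun z => R.Gam z u v) y := by
  simp only [Gam, div_eq_mul_inv]
  exact (((hR.diff_G y hy _ ((R.H y).add_mem hu hv)).sub (hR.diff_G y hy _ hu)).sub
    (hR.diff_G y hy _ hv)).mul_const _

namespace LocalAssumptions

lemma nrm_sq (h : R.LocalAssumptions V θ x) {y : X} (hy : y ∈ V) {u : Y} (hu : u ∈ R.H y) :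
    R.nrm θ y u ^ 2 = R.Gval y u + θ y * R.Q y u :=
  Real.sq_sqrt (h.gval_nonneg hy hu)

lemma H_eq (h : R.LocalAssumptions V θ x) {y : X} (hy : y ∈ V) : R.H y = R.H x := by
  obtain ⟨C, -, hC⟩ := h.nrm_equiv
  exact (hC y hy).1

/-- Local Lipschitz bound for the bilinear forms, relative to the norm `N(x, ·)`. -/
lemma exists_ball (h : R.LocalAssumptions V θ x) (hR : R.StandingAssumptions Ω) (hV : V ∈ 𝓝 x)
    (hVΩ : V ⊆ Ω) : ∃ r > 0, ∃ K > 0, Metric.ball x r ⊆ V ∧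
      ∀ y ∈ Metric.ball x r, ∀ u ∈ R.H x, ∀ v ∈ R.H x,
        |R.Gam y u v - R.Gam x u v| ≤ K * (R.nrm θ x u * R.nrm θ x v) * ‖y - x‖ ∧
        |R.B y u v - R.B x u v| ≤ K * (R.nrm θ x u * R.nrm θ x v) * ‖y - x‖ := by
  obtain ⟨r, hr, hrV⟩ := Metric.mem_nhds_iff.1 hV
  obtain ⟨C, hC1, hC⟩ := h.nrm_equiv
  obtain ⟨C₀, hC₀, hD⟩ := h.deriv_bound
  have hC0 : 0 < C := by linarith
  have hn : ∀ y ∈ V, ∀ u ∈ R.H x, R.nrm θ y u ≤ C * R.nrm θ x u := fun y hy u hu => by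
    have := ((hC y hy).2 u hu).1
    rwa [inv_mul_le_iff₀ hC0] at this
  have hnn : ∀ y ∈ V, ∀ u ∈ R.H x, ∀ v ∈ R.H x, C₀ * (R.nrm θ y u * R.nrm θ y v) ≤
      C₀ * C ^ 2 * (R.nrm θ x u * R.nrm θ x v) := fun y hy u hu v hv => by
    have := mul_le_mul (hn y hy u hu) (hn y hy v hv) (Real.sqrt_nonneg _)
      (mul_nonneg hC0.le (Real.sqrt_nonneg _))
    calc _ ≤ C₀ * (C * R.nrm θ x u * (C * R.nrm θ x v)) := mul_le_mul_of_nonneg_left this hC₀.le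
      _ = _ := by ring
  refine ⟨r, hr, C₀ * C ^ 2, by positivity, hrV, fun y hy u hu v hv => ⟨?_, ?_⟩⟩
  · refine (convex_ball x r).norm_image_sub_le_of_norm_fderiv_le (𝕜 := ℝ)
      (f := fun z => R.Gam z u v) (fun z hz => ?_) (fun z hz => ?_) (Metric.mem_ball_self hr) hy
    all_goals
      have hu' : u ∈ R.H z := by rwa [h.H_eq (hrV hz)]
      have hv' : v ∈ R.H z := by rwa [h.H_eq (hrV hz)]
    · exact hR.differentiableAt_Gam (hVΩ (hrV hz)) hu' hv'
    · exact ((hD z (hrV hz) u hu' v hv').2).trans (hnn z (hrV hz) u hu v hv)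
  · refine (convex_ball x r).norm_image_sub_le_of_norm_fderiv_le (𝕜 := ℝ)
      (f := fun z => R.B z u v) (fun z hz => ?_) (fun z hz => ?_) (Metric.mem_ball_self hr) hy
    all_goals
      have hu' : u ∈ R.H z := by rwa [h.H_eq (hrV hz)]
      have hv' : v ∈ R.H z := by rwa [h.H_eq (hrV hz)]
    · exact hR.differentiableAt_B (hVΩ (hrV hz)) u v
    · exact ((hD z (hrV hz) u hu' v hv').1).trans (hnn z (hrV hz) u hu v hv)

end LocalAssumptions

/-- The eigenvalues are continuous. -/
theorem StandingAssumptions.continuousAt_lam (hR : R.StandingAssumptions Ω)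
    (hY : ¬ FiniteDimensional ℝ Y) (hx : x ∈ Ω) {k : ℕ} (hk : 1 ≤ k) :
    ContinuousAt (R.lam k) x := by
  obtain ⟨n, rfl⟩ := Nat.exists_eq_add_of_le' hk
  obtain ⟨V, hV, hVΩ, θ, h⟩ := hR.loc x hx
  obtain ⟨r, hr, K, hK, hrV, hKb⟩ := h.exists_ball hR hV hVΩ
  obtain ⟨C, hC1, hC⟩ := h.nrm_equiv
  obtain ⟨M, hM⟩ := h.theta_bdd
  have hxV := mem_of_mem_nhds hV
  obtain ⟨e, he⟩ := hR.exists_isEigenbasis hY hx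
  have hp : ∀ y ∈ V, ∀ u ∈ R.H x, R.nrm θ x u ^ 2 ≤ C ^ 2 * (R.Gval y u + M * R.Q y u) := by
    intro y hy u hu
    have h1 := ((hC y hy).2 u hu).2
    have h2 := pow_le_pow_left₀ (Real.sqrt_nonneg _) h1 2
    have huy : u ∈ R.H y := by rwa [h.H_eq hy]
    rw [mul_pow, h.nrm_sq hy huy] at h2
    refine h2.trans (mul_le_mul_of_nonneg_left ?_ (sq_nonneg C))
    have := mul_le_mul_of_nonneg_right (hM y hy) ((hR.Q_posDef y (hVΩ hy)).nonneg u)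
    linarith
  have hpos : ∀ y ∈ V, -M ≤ R.lam (n + 1) y := by
    intro y hy
    obtain ⟨e', he'⟩ := hR.exists_isEigenbasis hY (hVΩ hy)
    have h1 := h.gval_nonneg hy (he'.mem n)
    have h2 := he'.eigen n _ (he'.mem n)
    rw [Gam_self, B_self, he'.Q_eq_one] at h2
    rw [he'.Q_eq_one, h2] at h1
    linarith [hM y hy]
  rw [Metric.continuousAt_iff']
  intro ε hε
  set η := ε / 2 with hη
  have hη0 : 0 < η := by positivity
  set Λ := R.lam (n + 1) x with hΛ
  set D := C ^ 2 * (Λ + η + M) with hD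
  have hD0 : 0 ≤ D := mul_nonneg (sq_nonneg C) (by linarith [hpos x hxV])
  have hsmall : ∀ᶠ y in 𝓝 x, K * ‖y - x‖ * (1 + (|Λ| + |M| + 2 * η)) * D < η := by
    have hcont : Continuous fun y : X => K * ‖y - x‖ * (1 + (|Λ| + |M| + 2 * η)) * D := by fun_prop
    have := hcont.tendsto x
    simp only [sub_self, norm_zero, mul_zero, zero_mul] at this
    exact this.eventually_lt_const hη0
  filter_upwards [hsmall, Metric.ball_mem_nhds x hr] with y hy hyr
  have hyV := hrV hyr
  obtain ⟨e', he'⟩ := hR.exists_isEigenbasis hY (hVΩ hyV)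
  have hHy := h.H_eq hyV
  have hδ : 0 ≤ K * ‖y - x‖ := by positivity
  have hG : ∀ u ∈ R.H x, |R.Gval y u - R.Gval x u| ≤ K * ‖y - x‖ * R.nrm θ x u ^ 2 := by
    intro u hu
    have := (hKb y hyr u hu u hu).1
    rw [Gam_self, Gam_self] at this
    exact this.trans (by rw [sq]; linarith)
  have hQ : ∀ u ∈ R.H x, |R.Q y u - R.Q x u| ≤ K * ‖y - x‖ * R.nrm θ x u ^ 2 := by
    intro u hu
    have := (hKb y hyr u hu u hu).2
    rw [B_self, B_self] at this
    exact this.trans (by rw [sq]; linarith)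
  have hsm : ∀ a : ℝ, a ≤ Λ + η → -M ≤ a → K * ‖y - x‖ * (1 + |a + η|) * D ≤ η := by
    intro a ha1 ha2
    refine le_trans ?_ hy.le
    refine mul_le_mul_of_nonneg_right (mul_le_mul_of_nonneg_left ?_ hδ) hD0
    have : |a + η| ≤ |Λ| + |M| + 2 * η := by
      rw [abs_le]
      constructor
      · linarith [le_abs_self M, abs_nonneg Λ]
      · linarith [le_abs_self Λ, abs_nonneg M]
    linarith
  have hpD : ∀ y ∈ V, R.lam (n + 1) y ≤ Λ + η → ∀ u ∈ R.H x,
      R.Gval y u ≤ R.lam (n + 1) y * R.Q y u → R.nrm θ x u ^ 2 ≤ D * R.Q y u := by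
    intro y hy hly u hu hGu
    refine (hp y hy u hu).trans ?_
    rw [hD, mul_assoc]
    refine mul_le_mul_of_nonneg_left ?_ (sq_nonneg C)
    have := mul_le_mul_of_nonneg_right hly ((hR.Q_posDef y (hVΩ hy)).nonneg u)
    linarith
  have hup : R.lam (n + 1) y ≤ Λ + η :=
    lam_le_add he he' (hR.Q_posDef x hx) (hR.Q_posDef y (hVΩ hyV)) hHy.symm n hδ hG hQ
      (hpD x hxV (by linarith)) (hsm _ (by linarith) (hpos x hxV))
  have hlow : Λ ≤ R.lam (n + 1) y + η := by
    refine lam_le_add he' he (hR.Q_posDef y (hVΩ hyV)) (hR.Q_posDef x hx) hHy n hδ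
      (p := fun u => R.nrm θ x u ^ 2) ?_ ?_ ?_ (hsm _ hup (hpos y hyV))
    · intro u hu
      rw [abs_sub_comm]
      exact hG u (hHy ▸ hu)
    · intro u hu
      rw [abs_sub_comm]
      exact hQ u (hHy ▸ hu)
    · intro u hu
      exact hpD y hyV hup u (hHy ▸ hu)
  rw [Real.dist_eq, abs_lt]
  constructor <;> linarith

/-- Joint continuity of `B` along sequences. -/
lemma LocalAssumptions.tendsto_B (h : R.LocalAssumptions V θ x) (hR : R.StandingAssumptions Ω)
    (hVΩ : V ⊆ Ω) {zs : ℕ → X} (hzV : ∀ n, zs n ∈ V) (hz : Tendsto zs atTop (𝓝 x))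
    {us vs : ℕ → Y} {u v : Y} (hu : Tendsto (fun n => R.Q (zs n) (us n - u)) atTop (𝓝 0))
    (hv : Tendsto (fun n => R.Q (zs n) (vs n - v)) atTop (𝓝 0)) :
    Tendsto (fun n => R.B (zs n) (us n) (vs n)) atTop (𝓝 (R.B x u v)) := by
  have huv : Tendsto (fun n => R.Q (zs n) (us n + vs n - (u + v))) atTop (𝓝 0) := by
    have hb := (hu.const_mul 2).add (hv.const_mul 2)
    simp only [mul_zero, add_zero] at hb
    refine squeeze_zero (fun n => (hR.Q_posDef _ (hVΩ (hzV n))).nonneg _) (fun n => ?_) hb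
    rw [add_sub_add_comm]
    exact Q_add_le (hR.Q_posDef _ (hVΩ (hzV n))) _ _
  exact (((h.cont_Q zs _ _ hzV hz huv).1.sub (h.cont_Q zs _ _ hzV hz hu).1).sub
    (h.cont_Q zs _ _ hzV hz hv).1).div_const 2

/-- Normalized eigenvectors at points tending to `x` have a subsequence converging in norm to an
eigenvector at `x`. -/
lemma LocalAssumptions.exists_subseq_eigenvector (h : R.LocalAssumptions V θ x)
    (hR : R.StandingAssumptions Ω) (hY : ¬ FiniteDimensional ℝ Y) (hV : V ∈ 𝓝 x) (hVΩ : V ⊆ Ω)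
    {k : ℕ} (hk : 1 ≤ k) {zs : ℕ → X} (hzV : ∀ n, zs n ∈ V) (hz : Tendsto zs atTop (𝓝 x))
    {us : ℕ → Y} (hus : ∀ n, us n ∈ R.eigenspace k (zs n)) (hu1 : ∀ n, R.Q (zs n) (us n) = 1) :
    ∃ u ∈ R.eigenspace k x, ∃ s : ℕ → ℕ, StrictMono s ∧
      Tendsto (fun n => R.Q (zs (s n)) (us (s n) - u)) atTop (𝓝 0) ∧
      Tendsto (fun n => R.nrm θ (zs (s n)) (us (s n) - u)) atTop (𝓝 0) := by
  have hx : x ∈ Ω := hVΩ (mem_of_mem_nhds hV)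
  have hlam : Tendsto (fun n => R.lam k (zs n)) atTop (𝓝 (R.lam k x)) :=
    (hR.continuousAt_lam hY hx hk).tendsto.comp hz
  have hH : ∀ n, us n ∈ R.H (zs n) := fun n => (R.mem_eigenspace.1 (hus n)).1
  have hHx : ∀ n, us n ∈ R.H x := fun n => h.H_eq (hzV n) ▸ hH n
  have heig := fun n => (R.mem_eigenspace.1 (hus n)).2
  have hGv : ∀ n, R.Gval (zs n) (us n) = R.lam k (zs n) := fun n => by
    rw [← Gam_self, heig n _ (hH n), B_self, hu1, mul_one]
  obtain ⟨M, hM⟩ := h.theta_bdd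
  obtain ⟨M', hM'⟩ := hlam.bddAbove_range
  obtain ⟨u, huH, s, hs, hsQ, hsG⟩ := h.compactness zs us hzV hz hH ⟨√(M' + M), fun n => by
    refine Real.sqrt_le_sqrt ?_
    rw [hGv, hu1, mul_one]
    exact add_le_add (hM' (Set.mem_range_self n)) (hM _ (hzV n))⟩
  have hz' := hz.comp hs.tendsto_atTop
  have hzV' : ∀ n, zs (s n) ∈ V := fun n => hzV _
  have hlam' : Tendsto (fun n => R.lam k (zs (s n))) atTop (𝓝 (R.lam k x)) :=
    hlam.comp hs.tendsto_atTop
  have hBv : ∀ v, Tendsto (fun n => R.B (zs (s n)) (us (s n)) v) atTop (𝓝 (R.B x u v)) := by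
    intro v
    refine h.tendsto_B hR hVΩ hzV' hz' hsQ (vs := fun _ => v) ?_
    simp
  have hue : ∀ v ∈ R.H x, R.Gam x u v = R.lam k x * R.B x u v := by
    intro v hv
    refine tendsto_nhds_unique (hsG v hv) ((hlam'.mul (hBv v)).congr fun n => ?_)
    exact (heig _ v (h.H_eq (hzV' n) ▸ hv)).symm
  have hu1' : R.Q x u = 1 := by
    refine tendsto_nhds_unique (h.cont_Q _ _ _ hzV' hz' hsQ).1 ?_
    simp [hu1]
  have hGu : Tendsto (fun n => R.Gval (zs (s n)) u) atTop (𝓝 (R.Gval x u)) :=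
    (hR.diff_G x hx u huH).continuousAt.tendsto.comp hz'
  have hGx : R.Gval x u = R.lam k x := by
    rw [← Gam_self, hue u huH, B_self, hu1', mul_one]
  refine ⟨u, R.mem_eigenspace.2 ⟨huH, hue⟩, s, hs, hsQ, ?_⟩
  -- weak convergence and convergence of the energies `G = λ_k` give strong convergence
  have hGd : Tendsto (fun n => R.Gval (zs (s n)) (us (s n) - u)) atTop (𝓝 0) := by
    have := (hlam'.sub ((hsG u huH).const_mul 2)).add hGu
    rw [Gam_self, hGx, show R.lam k x - 2 * R.lam k x + R.lam k x = 0 by ring] at this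
    refine this.congr fun n => ?_
    rw [R.Gval_sub _ (hH _) (h.H_eq (hzV' n) ▸ huH), hGv]
  have hthQ : Tendsto (fun n => θ (zs (s n)) * R.Q (zs (s n)) (us (s n) - u)) atTop (𝓝 0) := by
    have hb := hsQ.const_mul M
    rw [mul_zero] at hb
    refine squeeze_zero (fun n => ?_) (fun n => ?_) hb
    · exact mul_nonneg (h.theta_pos _ (hzV' n)).le ((hR.Q_posDef _ (hVΩ (hzV' n))).nonneg _)
    · exact mul_le_mul_of_nonneg_right (hM _ (hzV' n)) ((hR.Q_posDef _ (hVΩ (hzV' n))).nonneg _)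
  have := (hGd.add hthQ).sqrt
  simpa [nrm] using this

/-- Compactness of orthonormal families of eigenvectors. -/
lemma LocalAssumptions.exists_subseq_family (h : R.LocalAssumptions V θ x)
    (hR : R.StandingAssumptions Ω) (hY : ¬ FiniteDimensional ℝ Y) (hV : V ∈ 𝓝 x) (hVΩ : V ⊆ Ω)
    (m : ℕ) {zs : ℕ → X} (hzV : ∀ n, zs n ∈ V) (hz : Tendsto zs atTop (𝓝 x))
    {us : ℕ → ℕ → Y} (hus : ∀ n, R.OrthonormalFamily (zs n) m (us n)) :
    ∃ u, R.OrthonormalFamily x m u ∧ ∃ s : ℕ → ℕ, StrictMono s ∧ ∀ k ∈ Finset.Icc 1 m,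
      Tendsto (fun n => R.Q (zs (s n)) (us (s n) k - u k)) atTop (𝓝 0) ∧
      Tendsto (fun n => R.nrm θ (zs (s n)) (us (s n) k - u k)) atTop (𝓝 0) := by
  have key : ∀ j ≤ m, ∃ u : ℕ → Y, ∃ s : ℕ → ℕ, StrictMono s ∧ ∀ k ∈ Finset.Icc 1 j,
      u k ∈ R.eigenspace k x ∧
      Tendsto (fun n => R.Q (zs (s n)) (us (s n) k - u k)) atTop (𝓝 0) ∧
      Tendsto (fun n => R.nrm θ (zs (s n)) (us (s n) k - u k)) atTop (𝓝 0) := by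
    intro j
    induction j with
    | zero => exact fun _ => ⟨fun _ => 0, id, strictMono_id, by simp⟩
    | succ j ih =>
      intro hj
      obtain ⟨u, s, hs, hu⟩ := ih (by omega)
      have hj' : j + 1 ∈ Finset.Icc 1 m := Finset.mem_Icc.2 ⟨by omega, hj⟩
      obtain ⟨v, hv, s', hs', hvQ, hvN⟩ := h.exists_subseq_eigenvector hR hY hV hVΩ
        (Nat.succ_le_succ (Nat.zero_le j)) (fun n => hzV (s n)) (hz.comp hs.tendsto_atTop)
        (us := fun n => us (s n) (j + 1)) (fun n => (hus (s n)).1.1 _ hj')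
        (fun n => (hus (s n)).2 _ hj')
      refine ⟨Function.update u (j + 1) v, s ∘ s', hs.comp hs', fun k hk => ?_⟩
      by_cases hkj : k = j + 1
      · subst hkj
        simpa using ⟨hv, hvQ, hvN⟩
      · obtain ⟨h1, h2, h3⟩ := hu k (by
          rw [Finset.mem_Icc] at hk ⊢
          omega)
        simp only [Function.update_of_ne hkj, Function.comp_apply]
        exact ⟨h1, h2.comp hs'.tendsto_atTop, h3.comp hs'.tendsto_atTop⟩
  obtain ⟨u, s, hs, hu⟩ := key m le_rfl
  have hz' := hz.comp hs.tendsto_atTop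
  refine ⟨u, ⟨⟨fun k hk => (hu k hk).1, fun k hk l hl hkl => ?_⟩, fun k hk => ?_⟩, s, hs,
    fun k hk => (hu k hk).2⟩
  · refine tendsto_nhds_unique
      (h.tendsto_B hR hVΩ (fun n => hzV (s n)) hz' (hu k hk).2.1 (hu l hl).2.1) ?_
    simp [(hus _).1.2 k hk l hl hkl]
  · refine tendsto_nhds_unique (h.cont_Q _ _ _ (fun n => hzV (s n)) hz' (hu k hk).2.1).1 ?_
    simp [(hus _).2 k hk]

/-- Along a subsequence, orthonormal families of eigenvectors at points tending to `x` converge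
in the sense that the derivatives `G_x`, `Q_x` converge. -/
theorem StandingAssumptions.exists_subseq_deriv (hR : R.StandingAssumptions Ω)
    (hY : ¬ FiniteDimensional ℝ Y) (hx : x ∈ Ω) (m : ℕ) {zs : ℕ → X}
    (hz : Tendsto zs atTop (𝓝 x)) {us : ℕ → ℕ → Y}
    (hus : ∀ n, R.OrthonormalFamily (zs n) m (us n)) :
    ∃ u, R.OrthonormalFamily x m u ∧ ∃ s : ℕ → ℕ, StrictMono s ∧ ∀ k ∈ Finset.Icc 1 m,
      Tendsto (fun n => R.Qx (zs (s n)) (us (s n) k)) atTop (𝓝 (R.Qx x (u k))) ∧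
      Tendsto (fun n => R.Gx (zs (s n)) (us (s n) k)) atTop (𝓝 (R.Gx x (u k))) := by
  obtain ⟨V, hV, hVΩ, θ, h⟩ := hR.loc x hx
  obtain ⟨n₀, hn₀⟩ := eventually_atTop.1 (hz.eventually_mem hV)
  have hzV : ∀ n, zs (n + n₀) ∈ V := fun n => hn₀ _ (by omega)
  have hz' := hz.comp (tendsto_add_atTop_nat n₀)
  obtain ⟨u, hu, s, hs, hk⟩ := h.exists_subseq_family hR hY hV hVΩ m hzV hz'
    (us := fun n => us (n + n₀)) (fun n => hus _)
  have hz'' := hz'.comp hs.tendsto_atTop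
  refine ⟨u, hu, fun n => s n + n₀, fun a b hab => Nat.add_lt_add_right (hs hab) n₀,
    fun k hkm => ⟨?_, ?_⟩⟩
  · exact (h.cont_Q _ _ _ (fun n => hzV (s n)) hz'' (hk k hkm).1).2
  · exact (h.cont_G _ _ _ (fun n => hzV (s n)) hz''
      (fun n => (R.mem_eigenspace.1 ((hus _).1.1 k hkm)).1)
      (R.mem_eigenspace.1 (hu.1.1 k hkm)).1 (hk k hkm).2).2

/-- First-order perturbation of the eigenvalues along a ray, up to a subsequence. The eigenvalue
equation at `x + t h` is tested with the limit eigenvector and the one at `x` with the perturbed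
eigenvector; neither simplicity nor differentiability of the eigenvalues is needed. -/
theorem StandingAssumptions.exists_subseq_slope (hR : R.StandingAssumptions Ω)
    (hY : ¬ FiniteDimensional ℝ Y) (hx : x ∈ Ω) (m : ℕ) {t : ℕ → ℝ}
    (ht : Tendsto t atTop (𝓝[>] 0)) (v : X) :
    ∃ u, R.OrthonormalFamily x m u ∧ ∃ s : ℕ → ℕ, StrictMono s ∧ ∀ k ∈ Finset.Icc 1 m,
      Tendsto (fun n => (t (s n))⁻¹ * (R.lam k (x + t (s n) • v) - R.lam k x)) atTop
        (𝓝 (R.Gx x (u k) v - R.lam k x * R.Qx x (u k) v)) := by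
  obtain ⟨V, hV, hVΩ, θ, h⟩ := hR.loc x hx
  obtain ⟨r, hr, K, hK, hrV, hKb⟩ := h.exists_ball hR hV hVΩ
  obtain ⟨C, hC1, hC⟩ := h.nrm_equiv
  have ht0 : Tendsto t atTop (𝓝 0) := tendsto_nhds_of_tendsto_nhdsWithin ht
  have htpos : ∀ᶠ n in atTop, 0 < t n := ht.eventually_mem self_mem_nhdsWithin
  have hz0 : Tendsto (fun n => x + t n • v) atTop (𝓝 x) := by
    have := (ht0.smul_const v).const_add x
    simpa using this
  obtain ⟨n₀, hn₀⟩ := eventually_atTop.1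
    ((hz0.eventually_mem (Metric.ball_mem_nhds x hr)).and htpos)
  set τ : ℕ → ℝ := fun n => t (n + n₀) with hτ
  have hτ0 : ∀ n, 0 < τ n := fun n => (hn₀ _ (by omega)).2
  have hzr : ∀ n, x + τ n • v ∈ Metric.ball x r := fun n => (hn₀ _ (by omega)).1
  have hzV : ∀ n, x + τ n • v ∈ V := fun n => hrV (hzr n)
  have hz : Tendsto (fun n => x + τ n • v) atTop (𝓝 x) := hz0.comp (tendsto_add_atTop_nat n₀)
  have hτt : Tendsto τ atTop (𝓝[>] 0) := ht.comp (tendsto_add_atTop_nat n₀)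
  choose e he using fun n => hR.exists_isEigenbasis hY (hVΩ (hzV n))
  have hus := fun n => (he n).orthonormalFamily m
  obtain ⟨u, hu, s, hs, hk⟩ := h.exists_subseq_family hR hY hV hVΩ m hzV hz hus
  refine ⟨u, hu, fun n => s n + n₀, fun a b hab => Nat.add_lt_add_right (hs hab) n₀,
    fun k hkm => ?_⟩
  change Tendsto (fun n => (τ (s n))⁻¹ * (R.lam k (x + τ (s n) • v) - R.lam k x)) atTop _
  set w : ℕ → Y := fun n => e (s n) (k - 1) with hw
  set z : ℕ → X := fun n => x + τ (s n) • v with hzdef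
  obtain ⟨huH, hue⟩ := R.mem_eigenspace.1 (hu.1.1 k hkm)
  have hws : ∀ n, w n ∈ R.H (z n) ∧
      ∀ y ∈ R.H (z n), R.Gam (z n) (w n) y = R.lam k (z n) * R.B (z n) (w n) y :=
    fun n => R.mem_eigenspace.1 ((hus (s n)).1.1 k hkm)
  have hzV' : ∀ n, z n ∈ V := fun n => hzV _
  have hHz : ∀ n, R.H (z n) = R.H x := fun n => h.H_eq (hzV' n)
  have hwx : ∀ n, w n ∈ R.H x := fun n => hHz n ▸ (hws n).1
  have hz' : Tendsto z atTop (𝓝 x) := hz.comp hs.tendsto_atTop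
  have hτs : Tendsto (fun n => τ (s n)) atTop (𝓝[>] 0) := hτt.comp hs.tendsto_atTop
  have hinv : Tendsto (fun n => ‖(τ (s n))⁻¹‖) atTop atTop := by
    have := tendsto_inv_nhdsGT_zero.comp hτs
    exact tendsto_norm_atTop_atTop.comp this
  have hB1 : Tendsto (fun n => R.B (z n) (w n) (u k)) atTop (𝓝 1) := by
    have := h.tendsto_B hR hVΩ hzV' hz' (hk k hkm).1 (vs := fun _ => u k) (v := u k) (by simp)
    rwa [B_self, hu.2 k hkm] at this
  have hN : Tendsto (fun n => R.nrm θ x (w n - u k)) atTop (𝓝 0) := by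
    have hb := (hk k hkm).2.const_mul C
    rw [mul_zero] at hb
    exact squeeze_zero (fun n => Real.sqrt_nonneg _)
      (fun n => ((hC (z n) (hzV' n)).2 _ ((R.H x).sub_mem (hwx n) huH)).2) hb
  have hsmall : ∀ f : X → Y → Y → ℝ, (∀ n, |f (z n) (w n - u k) (u k) - f x (w n - u k) (u k)| ≤
      K * (R.nrm θ x (w n - u k) * R.nrm θ x (u k)) * ‖z n - x‖) →
      Tendsto (fun n => (τ (s n))⁻¹ * (f (z n) (w n - u k) (u k) - f x (w n - u k) (u k)))
        atTop (𝓝 0) := by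
    intro f hf
    have hb : Tendsto (fun n => K * (R.nrm θ x (w n - u k) * R.nrm θ x (u k)) * ‖v‖)
        atTop (𝓝 0) := by
      have := ((hN.mul_const (R.nrm θ x (u k))).const_mul K).mul_const ‖v‖
      simpa using this
    refine squeeze_zero_norm (fun n => ?_) hb
    have hp := hτ0 (s n)
    rw [norm_mul, Real.norm_eq_abs, Real.norm_eq_abs, abs_inv, abs_of_pos hp,
      inv_mul_le_iff₀ hp]
    refine (hf n).trans (le_of_eq ?_)
    rw [hzdef]
    simp only [add_sub_cancel_left, norm_smul, Real.norm_eq_abs, abs_of_pos hp]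
    ring
  have hslope : ∀ f : X → ℝ, DifferentiableAt ℝ f x →
      Tendsto (fun n => (τ (s n))⁻¹ * (f (z n) - f x)) atTop (𝓝 (fderiv ℝ f x v)) := by
    intro f hf
    have := hf.hasFDerivAt.lim v hinv
    simpa only [inv_inv, smul_eq_mul] using this
  -- up to a negligible term, `w n` may be replaced by its limit `u k` in the difference quotients
  have hGt : Tendsto (fun n => (τ (s n))⁻¹ * (R.Gam (z n) (w n) (u k) - R.Gam x (w n) (u k)))
      atTop (𝓝 (R.Gx x (u k) v)) := by
    have h1 := hsmall R.Gam fun n =>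
      (hKb (z n) (hzr _) _ ((R.H x).sub_mem (hwx n) huH) _ huH).1
    have h2 := h1.add (hslope (fun y => R.Gval y (u k)) (hR.diff_G x hx _ huH))
    rw [zero_add] at h2
    refine h2.congr fun n => ?_
    have huz : u k ∈ R.H (z n) := (hHz n).symm ▸ huH
    rw [R.Gam_sub_left x (hwx n) huH huH, R.Gam_sub_left (z n) (hws n).1 huz huz, Gam_self,
      Gam_self]
    ring
  have hBt : Tendsto (fun n => (τ (s n))⁻¹ * (R.B (z n) (w n) (u k) - R.B x (w n) (u k)))
      atTop (𝓝 (R.Qx x (u k) v)) := by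
    have h1 := hsmall R.B fun n =>
      (hKb (z n) (hzr _) _ ((R.H x).sub_mem (hwx n) huH) _ huH).2
    have h2 := h1.add (hslope (fun y => R.Q y (u k)) (hR.diff_Q x hx _))
    rw [zero_add] at h2
    refine h2.congr fun n => ?_
    simp only [← B_self]
    simp only [B_eq, map_sub, LinearMap.sub_apply]
    ring
  -- subtracting the two tested eigenvalue equations leaves the quotient of `λ_k` times `hB1`
  have hfin := (hGt.sub (hBt.const_mul (R.lam k x))).div hB1 one_ne_zero
  rw [div_one] at hfin
  refine hfin.congr' ?_
  filter_upwards [hB1.eventually_ne one_ne_zero] with n hn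
  have huz : u k ∈ R.H (z n) := (hHz n).symm ▸ huH
  rw [Pi.div_apply, div_eq_iff hn, (hws n).2 _ huz, R.Gam_comm x, hue _ (hwx n), R.B_comm x (u k)]
  ring

end Local

end RayleighFamily

/-! ### First-order variations at Clarke critical points -/

namespace RayleighFamily

section Functional

variable {X Y : Type*} [NormedAddCommGroup X] [NormedSpace ℝ X] [AddCommGroup Y] [Module ℝ Y]
  {R : RayleighFamily X Y} {Ω : Set X} {x : X} {sc : X → ℝ} {N : ℕ} {F : (Fin N → ℝ) → ℝ}

/-- The first-order variation in the direction `v` of the tuple `(sc λ_1, …, sc λ_N)` computed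
with the eigenvectors `u 1, …, u N`. -/
noncomputable def scaledVar (R : RayleighFamily X Y) (sc : X → ℝ) (N : ℕ) (z : X) (u : ℕ → Y)
    (v : X) : Fin N → ℝ := fun i =>
  fderiv ℝ sc z v * R.lam (i + 1) z
    + sc z * (R.Gx z (u (i + 1)) v - R.lam (i + 1) z * R.Qx z (u (i + 1)) v)

/-- The first-order variation of the eigenvalue functional. -/
noncomputable def functionalVar (R : RayleighFamily X Y) (sc : X → ℝ) (F : (Fin N → ℝ) → ℝ)
    (z : X) (u : ℕ → Y) (v : X) : ℝ :=
  fderiv ℝ F (R.scaledLam sc N z) (R.scaledVar sc N z u v)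

lemma StandingAssumptions.continuousAt_scaledLam (hR : R.StandingAssumptions Ω)
    (hY : ¬ FiniteDimensional ℝ Y) (hx : x ∈ Ω) (hsc : ContinuousAt sc x) :
    ContinuousAt (R.scaledLam sc N) x :=
  continuousAt_pi.2 fun _ => hsc.mul (hR.continuousAt_lam hY hx (Nat.succ_le_succ (Nat.zero_le _)))

/-- Along a subsequence, the difference quotients of the functional converge to one of its
first-order variations. -/
lemma StandingAssumptions.exists_subseq_slope_functional (hR : R.StandingAssumptions Ω)
    (hY : ¬ FiniteDimensional ℝ Y) (hx : x ∈ Ω) (hsc : DifferentiableAt ℝ sc x)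
    (hF : ContDiff ℝ 1 F) {m : ℕ} (hm : N ≤ m) {t : ℕ → ℝ} (ht : Tendsto t atTop (𝓝[>] 0))
    (v : X) :
    ∃ u, R.OrthonormalFamily x m u ∧ ∃ s : ℕ → ℕ, StrictMono s ∧
      Tendsto (fun n => (t (s n))⁻¹ *
        (R.functional sc F (x + t (s n) • v) - R.functional sc F x)) atTop
        (𝓝 (R.functionalVar sc F x u v)) := by
  obtain ⟨u, hu, s, hs, hk⟩ := hR.exists_subseq_slope hY hx m ht v
  refine ⟨u, hu, s, hs, ?_⟩
  have hts : Tendsto (fun n => t (s n)) atTop (𝓝[>] 0) := ht.comp hs.tendsto_atTop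
  have hinv : Tendsto (fun n => ‖(t (s n))⁻¹‖) atTop atTop :=
    tendsto_norm_atTop_atTop.comp (tendsto_inv_nhdsGT_zero.comp hts)
  have hz : Tendsto (fun n => x + t (s n) • v) atTop (𝓝 x) := by
    have := ((tendsto_nhds_of_tendsto_nhdsWithin hts).smul_const v).const_add x
    simpa using this
  have hd : Tendsto (fun n => (t (s n))⁻¹ •
      (R.scaledLam sc N (x + t (s n) • v) - R.scaledLam sc N x)) atTop
      (𝓝 (R.scaledVar sc N x u v)) := by
    refine tendsto_pi_nhds.2 fun i => ?_
    have hi : (i : ℕ) + 1 ∈ Finset.Icc 1 m := Finset.mem_Icc.2 ⟨by omega, by omega⟩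
    have h1 : Tendsto (fun n => (t (s n))⁻¹ * (sc (x + t (s n) • v) - sc x)) atTop
        (𝓝 (fderiv ℝ sc x v)) := by
      have := hsc.hasFDerivAt.lim v hinv
      simpa only [inv_inv, smul_eq_mul] using this
    have h2 : Tendsto (fun n => R.lam (i + 1) (x + t (s n) • v)) atTop (𝓝 (R.lam (i + 1) x)) :=
      (hR.continuousAt_lam hY hx (Finset.mem_Icc.1 hi).1).tendsto.comp hz
    refine ((h1.mul h2).add ((hk _ hi).const_mul (sc x))).congr fun n => ?_
    simp only [Pi.smul_apply, Pi.sub_apply, scaledLam, smul_eq_mul]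
    ring
  have hFd : HasFDerivAt F (fderiv ℝ F (R.scaledLam sc N x)) (R.scaledLam sc N x) :=
    (hF.differentiable one_ne_zero _).hasFDerivAt
  have hd0 : Tendsto (fun n => R.scaledLam sc N (x + t (s n) • v) - R.scaledLam sc N x) atTop
      (𝓝 0) := by
    rw [← sub_self (R.scaledLam sc N x)]
    exact ((hR.continuousAt_scaledLam hY hx hsc.continuousAt).tendsto.comp hz).sub_const _
  have := (hFd.hasFDerivWithinAt (s := Set.univ)).lim hd0 (Eventually.of_forall fun _ => trivial) hd
  simpa only [add_sub_cancel, smul_eq_mul, functional, functionalVar] using this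

/-- If every first-order variation at `x` in the direction `v` is negative, then the first-order
variations at nearby points are bounded away from `0`. -/
lemma StandingAssumptions.exists_functionalVar_le (hR : R.StandingAssumptions Ω)
    (hY : ¬ FiniteDimensional ℝ Y) (hΩ : IsOpen Ω) (hx : x ∈ Ω) (hsc : ContDiffOn ℝ 1 sc Ω)
    (hF : ContDiff ℝ 1 F) {m : ℕ} (hm : N ≤ m) (v : X)
    (hneg : ∀ u, R.OrthonormalFamily x m u → R.functionalVar sc F x u v < 0) :
    ∃ ε > 0, ∀ᶠ z in 𝓝 x, ∀ u, R.OrthonormalFamily z m u → R.functionalVar sc F z u v ≤ -ε := by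
  by_contra! hcon
  have hex : ∀ n : ℕ, ∃ z ∈ Metric.ball x ((n : ℝ) + 1)⁻¹, ∃ u, R.OrthonormalFamily z m u ∧
      -((n : ℝ) + 1)⁻¹ < R.functionalVar sc F z u v := by
    intro n
    have hp : (0 : ℝ) < ((n : ℝ) + 1)⁻¹ := by positivity
    obtain ⟨z, ⟨u, hu⟩, hz⟩ := ((hcon _ hp).and_eventually (Metric.ball_mem_nhds x hp)).exists
    exact ⟨z, hz, u, hu⟩
  choose zs hzs us hus hlt using hex
  have h0 : Tendsto (fun n : ℕ => ((n : ℝ) + 1)⁻¹) atTop (𝓝 0) := by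
    simpa only [one_div] using tendsto_one_div_add_atTop_nhds_zero_nat (𝕜 := ℝ)
  have hz : Tendsto zs atTop (𝓝 x) :=
    tendsto_iff_dist_tendsto_zero.2
      (squeeze_zero (fun _ => dist_nonneg) (fun n => (Metric.mem_ball.1 (hzs n)).le) h0)
  obtain ⟨u, hu, s, hs, hk⟩ := hR.exists_subseq_deriv hY hx m hz hus
  have hzs' := hz.comp hs.tendsto_atTop
  have hscx : ContDiffAt ℝ 1 sc x := hsc.contDiffAt (hΩ.mem_nhds hx)
  have happ : ∀ (w : X) {φ : ℕ → X →L[ℝ] ℝ} {φ₀ : X →L[ℝ] ℝ}, Tendsto φ atTop (𝓝 φ₀) →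
      Tendsto (fun n => φ n w) atTop (𝓝 (φ₀ w)) := fun w _ _ h =>
    ((ContinuousLinearMap.apply ℝ ℝ w).continuous.tendsto _).comp h
  have hvec : Tendsto (fun n => R.scaledVar sc N (zs (s n)) (us (s n)) v) atTop
      (𝓝 (R.scaledVar sc N x u v)) := by
    refine tendsto_pi_nhds.2 fun i => ?_
    have hi : (i : ℕ) + 1 ∈ Finset.Icc 1 m := Finset.mem_Icc.2 ⟨by omega, by omega⟩
    have h1 : Tendsto (fun n => fderiv ℝ sc (zs (s n)) v) atTop (𝓝 (fderiv ℝ sc x v)) :=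
      happ v ((hscx.continuousAt_fderiv one_ne_zero).tendsto.comp hzs')
    have h2 : Tendsto (fun n => R.lam (i + 1) (zs (s n))) atTop (𝓝 (R.lam (i + 1) x)) :=
      (hR.continuousAt_lam hY hx (Finset.mem_Icc.1 hi).1).tendsto.comp hzs'
    have h3 : Tendsto (fun n => sc (zs (s n))) atTop (𝓝 (sc x)) :=
      hscx.continuousAt.tendsto.comp hzs'
    obtain ⟨hkQ, hkG⟩ := hk _ hi
    exact (h1.mul h2).add (h3.mul ((happ v hkG).sub (h2.mul (happ v hkQ))))
  have hΛ := (hR.continuousAt_scaledLam (N := N) hY hx hscx.continuousAt).tendsto.comp hzs'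
  have hvar : Tendsto (fun n => R.functionalVar sc F (zs (s n)) (us (s n)) v) atTop
      (𝓝 (R.functionalVar sc F x u v)) :=
    (isBoundedBilinearMap_apply.continuous.tendsto (fderiv ℝ F (R.scaledLam sc N x), _)).comp
      ((((hF.continuous_fderiv one_ne_zero).tendsto _).comp hΛ).prodMk_nhds hvec)
  have hge : 0 ≤ R.functionalVar sc F x u v := by
    have := le_of_tendsto_of_tendsto' (h0.comp hs.tendsto_atTop).neg hvar fun n => (hlt _).le
    simpa using this
  exact absurd (hneg u hu) hge.not_gt

/-- At a point whose Clarke subdifferential contains `0`, every direction has a nonnegative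
first-order variation. -/
theorem StandingAssumptions.exists_functionalVar_nonneg (hR : R.StandingAssumptions Ω)
    (hY : ¬ FiniteDimensional ℝ Y) (hΩ : IsOpen Ω) (hx : x ∈ Ω) (hsc : ContDiffOn ℝ 1 sc Ω)
    (hF : ContDiff ℝ 1 F) {m : ℕ} (hm : N ≤ m)
    (hcrit : (0 : X →L[ℝ] ℝ) ∈ clarkeSub (R.functional sc F) x) (v : X) :
    ∃ u, R.OrthonormalFamily x m u ∧ 0 ≤ R.functionalVar sc F x u v := by
  by_contra! hneg
  obtain ⟨ε, hε, hev⟩ := hR.exists_functionalVar_le hY hΩ hx hsc hF hm v hneg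
  obtain ⟨r, hr, hball⟩ := Metric.mem_nhds_iff.1 (inter_mem hev (hΩ.mem_nhds hx))
  have hev' : ∀ᶠ p : X × ℝ in 𝓝 x ×ˢ 𝓝[>] (0 : ℝ),
      (R.functional sc F (p.1 + p.2 • v) - R.functional sc F p.1) / p.2 ≤ -(ε / 2) := by
    have h1 : ∀ᶠ t : ℝ in 𝓝[>] (0 : ℝ), 0 < t ∧ t * ‖v‖ < r / 2 := by
      refine (eventually_mem_nhdsWithin).and ?_
      have hc : Tendsto (fun t : ℝ => t * ‖v‖) (𝓝 0) (𝓝 (0 * ‖v‖)) :=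
        (continuous_id.mul continuous_const).tendsto 0
      rw [zero_mul] at hc
      exact (hc.mono_left nhdsWithin_le_nhds).eventually_lt_const (half_pos hr)
    filter_upwards [prod_mem_prod (Metric.ball_mem_nhds x (half_pos hr)) h1]
    rintro ⟨y, t⟩ ⟨hy, ht, htv⟩
    simp only at hy ht htv ⊢
    have hseg : ∀ a ∈ Set.Icc 0 t, y + a • v ∈ Metric.ball x r := by
      intro a ha
      rw [Metric.mem_ball, dist_eq_norm] at hy ⊢
      calc ‖y + a • v - x‖ = ‖(y - x) + a • v‖ := by congr 1; abel
        _ ≤ ‖y - x‖ + ‖a • v‖ := norm_add_le _ _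
        _ < r / 2 + r / 2 := by
          refine add_lt_add hy (lt_of_le_of_lt ?_ htv)
          rw [norm_smul, Real.norm_eq_abs, abs_of_nonneg ha.1]
          exact mul_le_mul_of_nonneg_right ha.2 (norm_nonneg v)
        _ = r := add_halves r
    set f : ℝ → ℝ := fun a => R.functional sc F (y + a • v) with hf
    have hcont : ContinuousOn f (Set.Icc 0 t) := by
      intro a ha
      have hz : y + a • v ∈ Ω := (hball (hseg a ha)).2
      have h2 : ContinuousAt (R.functional sc F) (y + a • v) :=
        hF.continuous.continuousAt.comp (hR.continuousAt_scaledLam hY hz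
          (hsc.contDiffAt (hΩ.mem_nhds hz)).continuousAt)
      have h3 : ContinuousAt (fun a : ℝ => y + a • v) a := by fun_prop
      exact (ContinuousAt.comp (f := fun a : ℝ => y + a • v) h2 h3).continuousWithinAt
    have hle := image_le_of_liminf_slope_right_lt_deriv_boundary' (f' := fun _ => -ε)
      (B := fun a => f 0 - ε / 2 * a) (B' := fun _ => -(ε / 2)) hcont ?_ (by simp)
      (by fun_prop) ?_ (fun _ _ _ => by linarith) (Set.right_mem_Icc.2 ht.le)
    · rw [div_le_iff₀ ht]
      simp only [hf, zero_smul, add_zero] at hle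
      linarith
    · -- the right lower Dini derivative, estimated along a sequence
      intro a ha ρ hρ
      have haI : a ∈ Set.Icc 0 t := ⟨ha.1, ha.2.le⟩
      have hz : y + a • v ∈ Ω := (hball (hseg a haI)).2
      have hτ : Tendsto (fun n : ℕ => ((n : ℝ) + 1)⁻¹) atTop (𝓝[>] 0) := by
        refine tendsto_nhdsWithin_iff.2 ⟨?_, Eventually.of_forall fun n => ?_⟩
        · simpa only [one_div] using tendsto_one_div_add_atTop_nhds_zero_nat (𝕜 := ℝ)
        · exact Set.mem_Ioi.2 (by positivity)
      obtain ⟨u, hu, s, hs, hlim⟩ := hR.exists_subseq_slope_functional hY hz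
        ((hsc.contDiffAt (hΩ.mem_nhds hz)).differentiableAt one_ne_zero) hF hm hτ v
      have hlt := hlim.eventually_lt_const (((hball (hseg a haI)).1 u hu).trans_lt hρ)
      have hto : Tendsto (fun n => a + ((s n : ℝ) + 1)⁻¹) atTop (𝓝[>] a) := by
        have h4 := hτ.comp hs.tendsto_atTop
        refine tendsto_nhdsWithin_iff.2 ⟨?_, Eventually.of_forall fun n => ?_⟩
        · have := (tendsto_nhds_of_tendsto_nhdsWithin h4).const_add a
          simpa using this
        · have : (0 : ℝ) < ((s n : ℝ) + 1)⁻¹ := by positivity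
          exact Set.mem_Ioi.2 (by linarith)
      refine hto.frequently (hlt.mono fun n hn => ?_).frequently
      rw [slope_def_field, add_sub_cancel_left, div_eq_inv_mul]
      simp only [hf, add_smul, ← add_assoc]
      exact hn
    · intro a _
      have h5 : HasDerivAt (fun a => f 0 - ε / 2 * a) (-(ε / 2)) a := by
        simpa using ((hasDerivAt_id a).const_mul (ε / 2)).const_sub (f 0)
      exact h5.hasDerivWithinAt
  have hup : clarkeUpper (R.functional sc F) x v ≤ ((-(ε / 2) : ℝ) : EReal) :=
    limsup_le_of_le (h := hev'.mono fun p hp => EReal.coe_le_coe_iff.2 hp)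
  have h0 := (hcrit v).trans hup
  rw [EReal.coe_le_coe_iff, zero_apply] at h0
  linarith

/-- Changing the sign of the functional exchanges the two Clarke differentials. -/
lemma zero_mem_clarkeSub_neg (h : (0 : X →L[ℝ] ℝ) ∈ clarkeSuper (R.functional sc F) x) :
    (0 : X →L[ℝ] ℝ) ∈ clarkeSub (R.functional sc fun y => -F y) x := by
  intro v
  have h1 := h v
  have h2 : clarkeUpper (R.functional sc fun y => -F y) x v
      = -clarkeLower (R.functional sc F) x v := by
    rw [clarkeUpper, clarkeLower, ← EReal.limsup_neg]
    refine congrArg (fun f => limsup f _) (funext fun p => ?_)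
    rw [Pi.neg_apply, ← EReal.coe_neg]
    congr 1
    simp only [functional]
    ring
  rw [h2]
  simp only [zero_apply, EReal.coe_zero] at h1 ⊢
  rw [EReal.le_neg]
  simpa using h1

end Functional

end RayleighFamily

/-! ### Convex combinations of symmetric matrices with given spectrum -/

lemma convex_Mix {ι : Type*} (d : ι → ℝ) : Convex ℝ (Mix d) := convex_convexHull ℝ _

lemma isClosed_Mix {ι : Type*} [Finite ι] (d : ι → ℝ) : IsClosed (Mix d) :=
  (Set.finite_range _).isClosed_convexHull ℝ

/-- A doubly stochastic combination of the entries of `d` is a mixture of the permutations of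
`d`, by Birkhoff's theorem. -/
lemma mulVec_mem_Mix {κ : Type*} [Fintype κ] [DecidableEq κ] (d : κ → ℝ) {M : Matrix κ κ ℝ}
    (hM : M ∈ doublyStochastic ℝ κ) : M.mulVec d ∈ Mix d := by
  rw [← SetLike.mem_coe, doublyStochastic_eq_convexHull_permMatrix] at hM
  have hlin : IsLinearMap ℝ (fun M : Matrix κ κ ℝ => M.mulVec d) :=
    ⟨fun A B => Matrix.add_mulVec A B d, fun c A => Matrix.smul_mulVec c A d⟩
  refine convexHull_min (t := (fun M : Matrix κ κ ℝ => M.mulVec d) ⁻¹' Mix d) ?_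
    ((convex_Mix d).is_linear_preimage hlin) hM
  rintro _ ⟨σ, rfl⟩
  refine subset_convexHull ℝ _ ⟨σ, ?_⟩
  exact (Matrix.permMatrix_mulVec σ).symm

section Matrices

variable {κ : Type*} [Fintype κ] [DecidableEq κ]

/-- The compact convex set of symmetric matrices whose diagonal in every orthonormal basis is a
mixture of the permutations of `d`; it contains all symmetric matrices with spectrum `d`. The
bound on the entries only serves to make compactness evident. -/
def mixedMatrices (d : κ → ℝ) : Set (κ → κ → ℝ) :=
  {A | (∀ a b, A a b = A b a) ∧ (∀ a b, |A a b| ≤ ∑ k, |d k|) ∧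
    ∀ W ∈ Matrix.orthogonalGroup κ ℝ, (fun k => ∑ a, ∑ b, W k a * W k b * A a b) ∈ Mix d}

lemma isClosed_mixedMatrices (d : κ → ℝ) : IsClosed (mixedMatrices d) := by
  have h : mixedMatrices d = (⋂ a, ⋂ b, {A | A a b = A b a}) ∩
      ((⋂ a, ⋂ b, {A | |A a b| ≤ ∑ k, |d k|}) ∩ ⋂ W ∈ Matrix.orthogonalGroup κ ℝ,
        (fun A : κ → κ → ℝ => fun k => ∑ a, ∑ b, W k a * W k b * A a b) ⁻¹' Mix d) := by
    ext A
    simp [mixedMatrices]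
  rw [h]
  refine IsClosed.inter ?_ (IsClosed.inter ?_ ?_)
  · exact isClosed_iInter fun a => isClosed_iInter fun b => isClosed_eq (by fun_prop) (by fun_prop)
  · exact isClosed_iInter fun a => isClosed_iInter fun b => isClosed_le (by fun_prop) (by fun_prop)
  · exact isClosed_iInter fun W => isClosed_iInter fun _ =>
      (isClosed_Mix d).preimage (by fun_prop)

lemma isCompact_mixedMatrices (d : κ → ℝ) : IsCompact (mixedMatrices d) := by
  refine IsCompact.of_isClosed_subset
    (isCompact_univ_pi fun _ => isCompact_univ_pi fun _ =>
      isCompact_Icc (a := -∑ k, |d k|) (b := ∑ k, |d k|)) (isClosed_mixedMatrices d) ?_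
  intro A hA a _ b _
  exact abs_le.1 (hA.2.1 a b)

lemma convex_mixedMatrices (d : κ → ℝ) : Convex ℝ (mixedMatrices d) := by
  intro A hA B hB s t hs ht hst
  refine ⟨fun a b => ?_, fun a b => ?_, fun W hW => ?_⟩
  · simp only [Pi.add_apply, Pi.smul_apply, hA.1 a b, hB.1 a b]
  · have h1 := mul_le_mul_of_nonneg_left (hA.2.1 a b) hs
    have h2 := mul_le_mul_of_nonneg_left (hB.2.1 a b) ht
    simp only [Pi.add_apply, Pi.smul_apply, smul_eq_mul]
    calc |s * A a b + t * B a b| ≤ |s * A a b| + |t * B a b| := abs_add_le _ _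
      _ = s * |A a b| + t * |B a b| := by rw [abs_mul, abs_mul, abs_of_nonneg hs, abs_of_nonneg ht]
      _ ≤ (s + t) * ∑ k, |d k| := by linarith
      _ = _ := by rw [hst, one_mul]
  · have h := convex_Mix d (hA.2.2 W hW) (hB.2.2 W hW) hs ht hst
    convert h using 1
    ext k
    simp only [Pi.add_apply, Pi.smul_apply, smul_eq_mul, mul_add, Finset.sum_add_distrib,
      Finset.mul_sum]
    congr 1 <;> exact Finset.sum_congr rfl fun _ _ => Finset.sum_congr rfl fun _ _ => by ring

lemma transpose_mem_orthogonalGroup {O : Matrix κ κ ℝ} (hO : O ∈ Matrix.orthogonalGroup κ ℝ) :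
    O.transpose ∈ Matrix.orthogonalGroup κ ℝ := by
  rw [Matrix.mem_orthogonalGroup_iff]
  simpa [Matrix.star_eq_conjTranspose] using (Matrix.mem_orthogonalGroup_iff' κ ℝ).1 hO

lemma sum_row_mul_of_orthogonal {O : Matrix κ κ ℝ} (hO : O ∈ Matrix.orthogonalGroup κ ℝ) (k l : κ) :
    ∑ a, O k a * O l a = if k = l then 1 else 0 := by
  have := congrFun (congrFun ((Matrix.mem_orthogonalGroup_iff κ ℝ).1 hO) k) l
  simpa [Matrix.mul_apply, Matrix.one_apply, Matrix.star_apply] using this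

lemma sum_col_mul_of_orthogonal {O : Matrix κ κ ℝ} (hO : O ∈ Matrix.orthogonalGroup κ ℝ) (k l : κ) :
    ∑ a, O a k * O a l = if k = l then 1 else 0 := by
  have := congrFun (congrFun ((Matrix.mem_orthogonalGroup_iff' κ ℝ).1 hO) k) l
  simpa [Matrix.mul_apply, Matrix.one_apply, Matrix.star_apply] using this

lemma conj_mem_mixedMatrices (d : κ → ℝ) {O : Matrix κ κ ℝ} (hO : O ∈ Matrix.orthogonalGroup κ ℝ) :
    (fun a b => ∑ k, d k * (O k a * O k b)) ∈ mixedMatrices d := by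
  refine ⟨fun a b => Finset.sum_congr rfl fun k _ => by ring, fun a b => ?_, fun W hW => ?_⟩
  · refine (Finset.abs_sum_le_sum_abs _ _).trans (Finset.sum_le_sum fun k _ => ?_)
    rw [abs_mul, abs_mul]
    have h1 : ∀ a, |O k a| ≤ 1 := fun a => entry_norm_bound_of_unitary hO k a
    exact mul_le_of_le_one_right (abs_nonneg _) (mul_le_one₀ (h1 a) (abs_nonneg _) (h1 b))
  · -- the diagonal is the image of `d` under the squared entries of an orthogonal matrix
    set P : Matrix κ κ ℝ := W * O.transpose with hP
    have hPo : P ∈ Matrix.orthogonalGroup κ ℝ := mul_mem hW (transpose_mem_orthogonalGroup hO)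
    have hds : (Matrix.of fun i j => P i j ^ 2) ∈ doublyStochastic ℝ κ := by
      rw [mem_doublyStochastic_iff_sum]
      refine ⟨fun i j => sq_nonneg _, fun i => ?_, fun j => ?_⟩
      · simpa [sq] using sum_row_mul_of_orthogonal hPo i i
      · simpa [sq] using sum_col_mul_of_orthogonal hPo j j
    convert mulVec_mem_Mix d hds using 1
    ext k
    simp only [Matrix.mulVec, dotProduct, Matrix.of_apply, hP, Matrix.mul_apply,
      Matrix.transpose_apply, sq, Finset.mul_sum, Finset.sum_mul]
    rw [Finset.sum_congr rfl fun a _ => Finset.sum_comm, Finset.sum_comm]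
    refine Finset.sum_congr rfl fun l _ => ?_
    rw [Finset.sum_comm]
    exact Finset.sum_congr rfl fun a _ => Finset.sum_congr rfl fun b _ => by ring

lemma exists_diagonalization (d : κ → ℝ) {A : κ → κ → ℝ} (hA : A ∈ mixedMatrices d) :
    ∃ O ∈ Matrix.orthogonalGroup κ ℝ, ∃ dt ∈ Mix d, ∀ a b, A a b = ∑ k, dt k * (O k a * O k b) := by
  have hH : (Matrix.of A).IsHermitian := by
    ext a b
    simp [hA.1 a b]
  set U : Matrix κ κ ℝ := hH.eigenvectorUnitary.1 with hU
  have hUo : U ∈ Matrix.orthogonalGroup κ ℝ := hH.eigenvectorUnitary.2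
  have hUt : U.transpose ∈ Matrix.orthogonalGroup κ ℝ := transpose_mem_orthogonalGroup hUo
  have hspec : ∀ a b, A a b = ∑ k, hH.eigenvalues k * (U.transpose k a * U.transpose k b) := by
    intro a b
    have := congrFun (congrFun hH.spectral_theorem a) b
    rw [Unitary.conjStarAlgAut_apply, ← hU, Matrix.mul_apply] at this
    simp only [Matrix.of_apply, Matrix.mul_diagonal, Matrix.star_apply, star_trivial,
      Function.comp_apply, RCLike.ofReal_real_eq_id, id] at this
    rw [this]
    exact Finset.sum_congr rfl fun k _ => by rw [Matrix.transpose_apply, Matrix.transpose_apply]; ring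
  refine ⟨_, hUt, hH.eigenvalues, ?_, hspec⟩
  convert hA.2.2 _ hUt using 1
  ext k
  have h1 : ∀ j, ∑ a, ∑ b, U.transpose k a * U.transpose k b *
      (hH.eigenvalues j * (U.transpose j a * U.transpose j b))
      = hH.eigenvalues j * (if k = j then 1 else 0) := by
    intro j
    have h2 := sum_row_mul_of_orthogonal hUt k j
    calc _ = hH.eigenvalues j * ((∑ a, U.transpose k a * U.transpose j a) *
          ∑ b, U.transpose k b * U.transpose j b) := by
          rw [Finset.sum_mul_sum, Finset.mul_sum]
          refine Finset.sum_congr rfl fun a _ => ?_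
          rw [Finset.mul_sum]
          exact Finset.sum_congr rfl fun b _ => by ring
      _ = _ := by rw [h2]; split_ifs <;> ring
  simp only [hspec, Finset.mul_sum]
  rw [Finset.sum_congr rfl fun a _ => Finset.sum_comm, Finset.sum_comm]
  simp only [h1]
  simp

end Matrices

/-- Minimax: if in every direction `h` some choice of orthogonal matrices makes an affine
expression nonnegative, then for some orthogonal matrices and some mixtures of the coefficients
the corresponding linear form vanishes. -/
theorem exists_mix_eq_zero {ι : Type*} [Fintype ι] {κ : ι → Type*} [∀ i, Fintype (κ i)]
    [∀ i, DecidableEq (κ i)] (d : ∀ i, κ i → ℝ) {X : Type*} [AddCommGroup X] [Module ℝ X]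
    (ψ : ∀ i, κ i → κ i → Module.Dual ℝ X) (c : Module.Dual ℝ X)
    (hyp : ∀ h : X, ∃ O : ∀ i, Matrix (κ i) (κ i) ℝ,
      (∀ i, O i ∈ Matrix.orthogonalGroup (κ i) ℝ) ∧
      0 ≤ ∑ i, ∑ k, d i k * ∑ a, ∑ b, O i k a * O i k b * ψ i a b h + c h) :
    ∃ O : ∀ i, Matrix (κ i) (κ i) ℝ, (∀ i, O i ∈ Matrix.orthogonalGroup (κ i) ℝ) ∧
      ∃ dt : ∀ i, κ i → ℝ, (∀ i, dt i ∈ Mix (d i)) ∧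
      ∑ i, ∑ k, dt i k • ∑ a, ∑ b, (O i k a * O i k b) • ψ i a b + c = 0 := by
  let L : ((∀ i, κ i → κ i → ℝ) × ℝ) →ₗ[ℝ] Module.Dual ℝ X :=
    { toFun := fun p => ∑ i, ∑ a, ∑ b, p.1 i a b • ψ i a b + p.2 • c
      map_add' := fun p q => by
        simp only [Prod.fst_add, Prod.snd_add, Pi.add_apply, add_smul, Finset.sum_add_distrib]
        abel
      map_smul' := fun s p => by
        simp only [Prod.smul_fst, Prod.smul_snd, Pi.smul_apply, smul_eq_mul, mul_smul,
          Finset.smul_sum, smul_add, RingHom.id_apply] }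
  have hswap : ∀ (e : ∀ i, κ i → ℝ) (O : ∀ i, Matrix (κ i) (κ i) ℝ),
      L (fun i a b => ∑ k, e i k * (O i k a * O i k b), 1)
        = ∑ i, ∑ k, e i k • ∑ a, ∑ b, (O i k a * O i k b) • ψ i a b + c := by
    intro e O
    simp only [L, LinearMap.coe_mk, AddHom.coe_mk, one_smul]
    congr 1
    refine Finset.sum_congr rfl fun i _ => ?_
    simp only [Finset.sum_smul, Finset.smul_sum, smul_smul]
    rw [Finset.sum_congr rfl fun a _ => Finset.sum_comm, Finset.sum_comm]
  let C : Set ((∀ i, κ i → κ i → ℝ) × ℝ) := (Set.univ.pi fun i => mixedMatrices (d i)) ×ˢ {1}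
  by_cases hdisj : Disjoint C (LinearMap.ker L : Set ((∀ i, κ i → κ i → ℝ) × ℝ))
  swap
  · obtain ⟨⟨A, s⟩, ⟨hA, hs⟩, hker⟩ := Set.not_disjoint_iff.1 hdisj
    obtain rfl : s = 1 := hs
    choose O hO dt hdt hdiag using fun i => exists_diagonalization (d i) (hA i trivial)
    refine ⟨O, hO, dt, hdt, ?_⟩
    rw [← hswap]
    rw [SetLike.mem_coe, LinearMap.mem_ker] at hker
    rw [← hker]
    congr 2
    ext i a b
    exact (hdiag i a b).symm
  -- otherwise separate `C` from the kernel of `L`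
  exfalso
  obtain ⟨f, u, v, hfu, huv, hfv⟩ := geometric_hahn_banach_compact_closed
    ((convex_pi fun i _ => convex_mixedMatrices (d i)).prod (convex_singleton 1))
    ((isCompact_univ_pi fun i => isCompact_mixedMatrices (d i)).prod isCompact_singleton)
    (LinearMap.ker L).convex (Submodule.closed_of_finiteDimensional _) hdisj
  have hv0 : v < 0 := by simpa using hfv 0 (zero_mem _)
  have hf0 : ∀ p ∈ LinearMap.ker L, f p = 0 := by
    intro p hp
    by_contra hne
    have := hfv ((v / f p) • p) (Submodule.smul_mem _ _ hp)
    rw [map_smul, smul_eq_mul, div_mul_cancel₀ _ hne] at this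
    exact lt_irrefl _ this
  -- a linear form vanishing on the kernel is the evaluation at some direction
  obtain ⟨h, hh⟩ : ∃ h, L.flip h = (f : ((∀ i, κ i → κ i → ℝ) × ℝ) →ₗ[ℝ] ℝ) := by
    rw [← LinearMap.mem_range, ← Subspace.dualCoannihilator_dualAnnihilator_eq
      (W := LinearMap.range L.flip), Submodule.mem_dualAnnihilator]
    intro p hp
    rw [Submodule.mem_dualCoannihilator] at hp
    refine hf0 p (LinearMap.mem_ker.2 (LinearMap.ext fun h => ?_))
    exact hp _ (LinearMap.mem_range_self L.flip h)
  obtain ⟨O, hO, hge⟩ := hyp h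
  have h1 := hfu (fun i a b => ∑ k, d i k * (O i k a * O i k b), 1)
    ⟨fun i _ => conj_mem_mixedMatrices (d i) (hO i), rfl⟩
  have h2 : f (fun i a b => ∑ k, d i k * (O i k a * O i k b), 1)
      = L (fun i a b => ∑ k, d i k * (O i k a * O i k b), 1) h :=
    (LinearMap.congr_fun hh _).symm
  rw [h2, hswap] at h1
  simp only [LinearMap.add_apply, LinearMap.sum_apply, LinearMap.smul_apply, smul_eq_mul] at h1
  linarith

/-! ### Distinct eigenvalues and blocks of indices -/

namespace RayleighFamily

namespace IsEigenbasis

variable {X Y : Type*} [AddCommGroup Y] [Module ℝ Y] {R : RayleighFamily X Y} {x : X} {e : ℕ → Y}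

lemma lam_tendsto (h : R.IsEigenbasis x e) : Tendsto (fun k => R.lam k x) atTop atTop :=
  (tendsto_add_atTop_iff_nat 1).1 h.tendsto

lemma exists_least_lam_gt (h : R.IsEigenbasis x e) (a : ℝ) :
    ∃ k, 1 ≤ k ∧ a < R.lam k x ∧ ∀ j, 1 ≤ j → a < R.lam j x → R.lam k x ≤ R.lam j x := by
  classical
  have hex : ∃ k, 1 ≤ k ∧ a < R.lam k x :=
    ((eventually_ge_atTop 1).and (h.lam_tendsto.eventually_gt_atTop a)).exists
  refine ⟨Nat.find hex, (Nat.find_spec hex).1, (Nat.find_spec hex).2, fun j hj hja => ?_⟩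
  exact h.lam_mono (Nat.find_spec hex).1 (Nat.find_min' hex ⟨hj, hja⟩)

lemma mu_one (h : R.IsEigenbasis x e) : R.mu x 1 = R.lam 1 x := by
  refine IsLeast.csInf_eq ⟨⟨1, le_rfl, rfl⟩, ?_⟩
  rintro _ ⟨k, hk, rfl⟩
  exact h.lam_mono le_rfl hk

/-- `μ_{i+1}` is the smallest eigenvalue above `μ_i`. -/
lemma mu_succ_spec (h : R.IsEigenbasis x e) {i : ℕ} (hi : 1 ≤ i) :
    ∃ k, 1 ≤ k ∧ R.mu x (i + 1) = R.lam k x ∧ R.mu x i < R.lam k x ∧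
      ∀ j, 1 ≤ j → R.mu x i < R.lam j x → R.lam k x ≤ R.lam j x := by
  obtain ⟨i, rfl⟩ := Nat.exists_eq_add_of_le' hi
  obtain ⟨k, hk, hlt, hmin⟩ := h.exists_least_lam_gt (R.mu x (i + 1))
  refine ⟨k, hk, IsLeast.csInf_eq ⟨⟨⟨k, hk, rfl⟩, hlt⟩, ?_⟩, hlt, hmin⟩
  rintro _ ⟨⟨j, hj, rfl⟩, hjl⟩
  exact hmin j hj hjl

lemma mu_strictMono (h : R.IsEigenbasis x e) : StrictMono fun i => R.mu x (i + 1) := by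
  refine strictMono_nat_of_lt_succ fun i => ?_
  obtain ⟨k, -, h1, h2, -⟩ := h.mu_succ_spec (Nat.succ_le_succ (Nat.zero_le i))
  rw [h1]
  exact h2

lemma mu_le_mu (h : R.IsEigenbasis x e) {i j : ℕ} (hi : 1 ≤ i) (hj : 1 ≤ j) :
    R.mu x i ≤ R.mu x j ↔ i ≤ j := by
  obtain ⟨i, rfl⟩ := Nat.exists_eq_add_of_le' hi
  obtain ⟨j, rfl⟩ := Nat.exists_eq_add_of_le' hj
  rw [h.mu_strictMono.le_iff_le]
  omega

/-- Every eigenvalue is one of the `μ_i`. -/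
lemma exists_mu_eq (h : R.IsEigenbasis x e) {k : ℕ} (hk : 1 ≤ k) :
    ∃ i, 1 ≤ i ∧ R.mu x i = R.lam k x := by
  by_contra! hcon
  have hlt : ∀ i, R.mu x (i + 1) < R.lam k x := by
    intro i
    refine lt_of_le_of_ne ?_ (hcon (i + 1) (by omega))
    induction i with
    | zero => rw [h.mu_one]; exact h.lam_mono le_rfl hk
    | succ i ih =>
      obtain ⟨j, -, h1, -, h3⟩ := h.mu_succ_spec (Nat.succ_le_succ (Nat.zero_le i))
      rw [h1]
      exact h3 k hk (lt_of_le_of_ne ih (hcon (i + 1) (by omega)))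
  have hex : ∀ i, ∃ j, 1 ≤ j ∧ R.mu x (i + 1) = R.lam j x := by
    intro i
    rcases i with - | i
    · exact ⟨1, le_rfl, h.mu_one⟩
    · obtain ⟨j, hj, h1, -, -⟩ := h.mu_succ_spec (Nat.succ_le_succ (Nat.zero_le i))
      exact ⟨j, hj, h1⟩
  choose j hj1 hj using hex
  have hinj : Function.Injective j := by
    intro a b hab
    refine h.mu_strictMono.injective ?_
    simp only [hj, hab]
  refine Set.infinite_range_of_injective hinj ((Set.finite_Iio k).subset ?_)
  rintro _ ⟨i, rfl⟩
  by_contra hge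
  have := h.lam_mono hk (not_lt.1 hge)
  rw [← hj] at this
  exact absurd (hlt i) this.not_gt

lemma clusterIdx_spec (h : R.IsEigenbasis x e) {k : ℕ} (hk : 1 ≤ k) :
    1 ≤ R.clusterIdx k x ∧ R.mu x (R.clusterIdx k x) = R.lam k x :=
  Nat.sInf_mem (h.exists_mu_eq hk)

lemma mem_aleph_iff (h : R.IsEigenbasis x e) {i k : ℕ} (hi : 1 ≤ i) :
    k ∈ R.aleph i x ↔ 1 ≤ k ∧ R.clusterIdx k x = i := by
  refine and_congr_right fun hk => ?_
  obtain ⟨h1, h2⟩ := h.clusterIdx_spec hk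
  refine ⟨fun heq => ?_, fun heq => by rw [← h2, heq]⟩
  rw [← h2] at heq
  exact le_antisymm ((h.mu_le_mu h1 hi).1 heq.le) ((h.mu_le_mu hi h1).1 heq.ge)

lemma finite_aleph (h : R.IsEigenbasis x e) (i : ℕ) : (R.aleph i x).Finite := by
  obtain ⟨n, hn⟩ := eventually_atTop.1 (h.lam_tendsto.eventually_gt_atTop (R.mu x i))
  refine (Set.finite_Iio n).subset fun k hk => ?_
  by_contra hge
  exact (hn k (not_lt.1 hge)).ne' hk.2

lemma le_topIdx_iff (h : R.IsEigenbasis x e) {N k : ℕ} (hN : 1 ≤ N) (hk : 1 ≤ k) :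
    k ≤ R.topIdx N x ↔ R.lam k x ≤ R.lam N x := by
  obtain ⟨h1, h2⟩ := h.clusterIdx_spec hN
  have hbdd := (h.finite_aleph (R.clusterIdx N x)).bddAbove
  have hNmem : N ∈ R.aleph (R.clusterIdx N x) x := ⟨hN, h2.symm⟩
  have htop : R.topIdx N x ∈ R.aleph (R.clusterIdx N x) x := Nat.sSup_mem ⟨N, hNmem⟩ hbdd
  have hNtop : N ≤ R.topIdx N x := le_csSup hbdd hNmem
  constructor
  · intro hle
    rw [← h2, ← htop.2]
    exact h.lam_mono hk hle
  · intro hle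
    rcases hle.lt_or_eq with hlt | heq
    · by_contra hgt
      exact absurd (h.lam_mono hN (hNtop.trans (not_le.1 hgt).le)) hlt.not_ge
    · exact le_csSup hbdd ⟨hk, by rw [h2, heq]⟩

lemma mem_Icc_topIdx (h : R.IsEigenbasis x e) {N k : ℕ} (hN : 1 ≤ N) :
    k ∈ Finset.Icc 1 (R.topIdx N x) ↔
      1 ≤ k ∧ R.clusterIdx k x ∈ Finset.Icc 1 (R.clusterIdx N x) := by
  rw [Finset.mem_Icc]
  refine and_congr_right fun hk => ?_
  obtain ⟨h1, h2⟩ := h.clusterIdx_spec hN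
  obtain ⟨h3, h4⟩ := h.clusterIdx_spec hk
  rw [h.le_topIdx_iff hN hk, Finset.mem_Icc, ← h2, ← h4, h.mu_le_mu h3 h1]
  simp [h3]

lemma le_topIdx (h : R.IsEigenbasis x e) {N : ℕ} (hN : 1 ≤ N) : N ≤ R.topIdx N x :=
  (h.le_topIdx_iff hN hN).2 le_rfl

lemma mem_Icc_of_mem_aleph (h : R.IsEigenbasis x e) {N i k : ℕ} (hN : 1 ≤ N)
    (hi : i ∈ Finset.Icc 1 (R.clusterIdx N x)) (hk : k ∈ R.aleph i x) :
    k ∈ Finset.Icc 1 (R.topIdx N x) := by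
  obtain ⟨h1, h2⟩ := (h.mem_aleph_iff (Finset.mem_Icc.1 hi).1).1 hk
  exact (h.mem_Icc_topIdx hN).2 ⟨h1, by rwa [h2]⟩

lemma exists_mem_aleph (h : R.IsEigenbasis x e) {N k : ℕ} (hN : 1 ≤ N)
    (hk : k ∈ Finset.Icc 1 (R.topIdx N x)) :
    ∃ i : Finset.Icc 1 (R.clusterIdx N x), k ∈ R.aleph i x := by
  obtain ⟨h1, h2⟩ := (h.mem_Icc_topIdx hN).1 hk
  exact ⟨⟨_, h2⟩, (h.mem_aleph_iff (Finset.mem_Icc.1 h2).1).2 ⟨h1, rfl⟩⟩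

/-- Summation over the indices up to `topIdx N`, sorted by eigenvalue. -/
lemma sum_Icc_topIdx (h : R.IsEigenbasis x e) {N : ℕ} (hN : 1 ≤ N)
    [∀ i, Fintype (R.aleph i x)] {Z : Type*} [AddCommMonoid Z] (f : ℕ → Z) :
    ∑ k ∈ Finset.Icc 1 (R.topIdx N x), f k
      = ∑ i : Finset.Icc 1 (R.clusterIdx N x), ∑ k : R.aleph i x, f k := by
  rw [← Finset.sum_fiberwise_of_maps_to (t := Finset.Icc 1 (R.clusterIdx N x))
    (g := fun k => R.clusterIdx k x) fun k hk => ((h.mem_Icc_topIdx hN).1 hk).2,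
    ← Finset.sum_coe_sort]
  refine Finset.sum_congr rfl fun i _ => ?_
  rw [Finset.sum_set_coe (f := f)]
  refine Finset.sum_congr ?_ fun _ _ => rfl
  ext k
  rw [Finset.mem_filter, Set.mem_toFinset, h.mem_aleph_iff (Finset.mem_Icc.1 i.2).1,
    h.mem_Icc_topIdx hN]
  constructor
  · rintro ⟨⟨h1, -⟩, h3⟩
    exact ⟨h1, h3⟩
  · rintro ⟨h1, h3⟩
    exact ⟨⟨h1, h3 ▸ i.2⟩, h3⟩

/-- Functions given on each block of indices are restrictions of one function on `ℕ`. -/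
lemma exists_glue (h : R.IsEigenbasis x e) {n : ℕ} {Z : Type*} [Zero Z]
    (f : ∀ i : Finset.Icc 1 n, R.aleph i x → Z) : ∃ g : ℕ → Z, ∀ (i : Finset.Icc 1 n) (k : R.aleph i x), g k = f i k := by
  classical
  refine ⟨fun k => if hk : R.clusterIdx k x ∈ Finset.Icc 1 n ∧ k ∈ R.aleph (R.clusterIdx k x) x
    then f ⟨R.clusterIdx k x, hk.1⟩ ⟨k, hk.2⟩ else 0, ?_⟩
  rintro ⟨i, hi⟩ ⟨k, hk⟩
  obtain ⟨h1, rfl⟩ := (h.mem_aleph_iff (Finset.mem_Icc.1 hi).1).1 hk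
  exact dif_pos ⟨hi, hk⟩

/-- Eigenvectors are combinations of the basis vectors from the same block. -/
lemma eq_sum_aleph (h : R.IsEigenbasis x e) (hQ : (R.Q x).PosDef) {i k : ℕ}
    [Fintype (R.aleph i x)] (hk : k ∈ R.aleph i x) {u : Y} (hu : u ∈ R.eigenspace k x) :
    u = ∑ a : R.aleph i x, R.B x u (e (a - 1)) • e (a - 1) := by
  classical
  have h1 := h.eq_sum hQ hu (s := (R.aleph i x).toFinset.image fun a => a - 1) fun n => by
    simp only [Finset.mem_image, Set.mem_toFinset]
    constructor
    · rintro ⟨a, ha, rfl⟩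
      rw [Nat.sub_add_cancel ha.1, ha.2, hk.2]
    · intro hn
      exact ⟨n + 1, ⟨by omega, by rw [hn, hk.2]⟩, rfl⟩
  rw [Finset.sum_image] at h1
  · exact h1.trans (Finset.sum_set_coe (R.aleph i x)
      (f := fun a => R.B x u (e (a - 1)) • e (a - 1))).symm
  · intro a ha b hb hab
    have ha1 := (Set.mem_toFinset.1 ha).1
    have hb1 := (Set.mem_toFinset.1 hb).1
    simp only at hab
    omega

end IsEigenbasis

end RayleighFamily

/-! ### The Euler–Lagrange equation -/

lemma pos_of_mem_Mix {ι : Type*} {d dt : ι → ℝ} (hdt : dt ∈ Mix d) (hd : ∀ k, 0 < d k) (k : ι) :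
    0 < dt k := by
  have hconv : Convex ℝ {f : ι → ℝ | 0 < f k} :=
    (convex_Ioi (0 : ℝ)).is_linear_preimage (f := fun f : ι → ℝ => f k)
      ⟨fun _ _ => rfl, fun _ _ => rfl⟩
  refine convexHull_min ?_ hconv hdt
  rintro _ ⟨σ, rfl⟩
  exact hd _

lemma neg_mem_Mix {ι : Type*} {d dt : ι → ℝ} (hdt : dt ∈ Mix (-d)) : -dt ∈ Mix d := by
  refine convexHull_min (t := (fun f : ι → ℝ => -f) ⁻¹' Mix d) ?_
    ((convex_Mix d).is_linear_preimage ⟨fun a b => neg_add a b, fun c a => (smul_neg c a).symm⟩) hdt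
  rintro _ ⟨σ, rfl⟩
  refine subset_convexHull ℝ _ ⟨σ, ?_⟩
  ext k
  simp

namespace RayleighFamily

section Combinations

variable {X Y : Type*} [AddCommGroup Y] [Module ℝ Y] {R : RayleighFamily X Y} {x : X}

lemma Gam_sum_sum (y : X) {κ : Type*} [Fintype κ] (c : κ → ℝ) {w : κ → Y}
    (hw : ∀ a, w a ∈ R.H y) :
    R.Gval y (∑ a, c a • w a) = ∑ a, ∑ b, c a * c b * R.Gam y (w a) (w b) := by
  have hsum : ∑ a, c a • w a = ((∑ a, c a • (⟨w a, hw a⟩ : R.H y) : R.H y) : Y) := by simp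
  rw [← Gam_self, hsum, Gam_coe]
  simp only [map_sum, LinearMap.sum_apply, map_smul, LinearMap.smul_apply, smul_eq_mul,
    Finset.mul_sum]
  rw [Finset.sum_comm]
  refine Finset.sum_congr rfl fun a _ => Finset.sum_congr rfl fun b _ => ?_
  rw [R.Gam_coe y ⟨w a, hw a⟩ ⟨w b, hw b⟩]
  ring

lemma B_sum_sum (y : X) {κ : Type*} [Fintype κ] (c c' : κ → ℝ) (w : κ → Y) :
    R.B y (∑ a, c a • w a) (∑ a, c' a • w a) = ∑ a, ∑ b, c a * c' b * R.B y (w a) (w b) := by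
  simp only [B_eq, map_sum, LinearMap.sum_apply, map_smul, LinearMap.smul_apply, smul_eq_mul,
    Finset.mul_sum]
  rw [Finset.sum_comm]
  exact Finset.sum_congr rfl fun a _ => Finset.sum_congr rfl fun b _ => by ring

lemma smul_mem_eigenspace {k : ℕ} (c : ℝ) {u : Y} (hu : u ∈ R.eigenspace k x) :
    c • u ∈ R.eigenspace k x := by
  obtain ⟨h1, h2⟩ := R.mem_eigenspace.1 hu
  refine R.mem_eigenspace.2 ⟨(R.H x).smul_mem c h1, fun v hv => ?_⟩
  rw [R.Gam_smul_left x c h1 hv, h2 v hv, B_eq, B_eq, map_smul, LinearMap.smul_apply, smul_eq_mul]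
  ring

lemma add_mem_eigenspace {k : ℕ} {u v : Y} (hu : u ∈ R.eigenspace k x)
    (hv : v ∈ R.eigenspace k x) : u + v ∈ R.eigenspace k x := by
  obtain ⟨h1, h2⟩ := R.mem_eigenspace.1 hu
  obtain ⟨h3, h4⟩ := R.mem_eigenspace.1 hv
  refine R.mem_eigenspace.2 ⟨(R.H x).add_mem h1 h3, fun w hw => ?_⟩
  rw [R.Gam_add_left x h1 h3 hw, h2 w hw, h4 w hw]
  simp only [B_eq, map_add, LinearMap.add_apply]
  ring

lemma sum_mem_eigenspace {k : ℕ} {κ : Type*} [Fintype κ] (c : κ → ℝ) {w : κ → Y}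
    (hw : ∀ a, w a ∈ R.eigenspace k x) : ∑ a, c a • w a ∈ R.eigenspace k x := by
  refine Finset.sum_induction _ (· ∈ R.eigenspace k x) (fun _ _ => add_mem_eigenspace) ?_
    fun a _ => smul_mem_eigenspace _ (hw a)
  refine R.mem_eigenspace.2 ⟨zero_mem _, fun v hv => ?_⟩
  have := R.Gam_smul_left x 0 (zero_mem _) hv
  rw [zero_smul, zero_mul] at this
  rw [this, B_eq, map_zero, LinearMap.zero_apply, mul_zero]

lemma eigenspace_congr {k l : ℕ} (h : R.lam k x = R.lam l x) :
    R.eigenspace k x = R.eigenspace l x := by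
  rw [eigenspace, eigenspace, h]

lemma IsEigenbasis.sum_mu_smul {e : ℕ → Y} (h : R.IsEigenbasis x e) {N : ℕ} (hN : 1 ≤ N)
    {Z : Type*} [AddCommGroup Z] [Module ℝ Z] (f : ℕ → Z) :
    ∑ i ∈ Finset.Icc 1 (R.clusterIdx N x), R.mu x i • ∑ᶠ k ∈ R.aleph i x, f k
      = ∑ k ∈ Finset.Icc 1 (R.topIdx N x), R.lam k x • f k := by
  let _ : ∀ i, Fintype (R.aleph i x) := fun i => (h.finite_aleph i).fintype
  rw [h.sum_Icc_topIdx hN, ← Finset.sum_coe_sort]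
  refine Finset.sum_congr rfl fun i _ => ?_
  rw [← finsum_set_coe_eq_finsum_mem, finsum_eq_sum_of_fintype, Finset.smul_sum]
  exact Finset.sum_congr rfl fun k _ => by rw [k.2.2]

end Combinations

section Derivatives

variable {X Y : Type*} [NormedAddCommGroup X] [NormedSpace ℝ X] [AddCommGroup Y] [Module ℝ Y]
  {R : RayleighFamily X Y} {Ω : Set X} {x : X}

lemma StandingAssumptions.eventually_H_eq (hR : R.StandingAssumptions Ω) (hx : x ∈ Ω) :
    ∀ᶠ y in 𝓝 x, R.H y = R.H x := by
  obtain ⟨V, hV, -, θ, h⟩ := hR.loc x hx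
  filter_upwards [hV] with y hy using h.H_eq hy

lemma StandingAssumptions.Gx_sum (hR : R.StandingAssumptions Ω) (hx : x ∈ Ω) {κ : Type*}
    [Fintype κ] (c : κ → ℝ) {w : κ → Y} (hw : ∀ a, w a ∈ R.H x) :
    R.Gx x (∑ a, c a • w a) = ∑ a, ∑ b, (c a * c b) • R.Gamx x (w a) (w b) := by
  have hev : (fun y => R.Gval y (∑ a, c a • w a)) =ᶠ[𝓝 x]
      fun y => ∑ a, ∑ b, c a * c b * R.Gam y (w a) (w b) := by
    filter_upwards [hR.eventually_H_eq hx] with y hy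
    exact Gam_sum_sum y c fun a => hy ▸ hw a
  rw [Gx, hev.fderiv_eq]
  exact (HasFDerivAt.fun_sum fun a _ => HasFDerivAt.fun_sum fun b _ =>
    (hR.differentiableAt_Gam hx (hw a) (hw b)).hasFDerivAt.const_mul (c a * c b)).fderiv

lemma StandingAssumptions.Qx_sum (hR : R.StandingAssumptions Ω) (hx : x ∈ Ω) {κ : Type*}
    [Fintype κ] (c : κ → ℝ) (w : κ → Y) :
    R.Qx x (∑ a, c a • w a) = ∑ a, ∑ b, (c a * c b) • R.Bx x (w a) (w b) := by
  have heq : (fun y => R.Q y (∑ a, c a • w a)) =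
      fun y => ∑ a, ∑ b, c a * c b * R.B y (w a) (w b) := by
    funext y
    rw [← B_self, B_sum_sum]
  rw [Qx, heq]
  exact (HasFDerivAt.fun_sum fun a _ => HasFDerivAt.fun_sum fun b _ =>
    (hR.differentiableAt_B hx (w a) (w b)).hasFDerivAt.const_mul (c a * c b)).fderiv

lemma StandingAssumptions.Gx_smul (hR : R.StandingAssumptions Ω) (hx : x ∈ Ω) (c : ℝ) {u : Y}
    (hu : u ∈ R.H x) : R.Gx x (c • u) = c ^ 2 • R.Gx x u := by
  simp only [Gx, Gval_smul]
  exact fderiv_const_mul (hR.diff_G x hx u hu) _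

lemma StandingAssumptions.Qx_smul (hR : R.StandingAssumptions Ω) (hx : x ∈ Ω) (c : ℝ) (u : Y) :
    R.Qx x (c • u) = c ^ 2 • R.Qx x u := by
  simp only [Qx, Q_smul]
  exact fderiv_const_mul (hR.diff_Q x hx u) _

/-- The first-order variation of the functional in terms of `d_k` and `S`. -/
lemma functionalVar_eq {sc : X → ℝ} {N J : ℕ} {F : (Fin N → ℝ) → ℝ} (hNJ : N ≤ J)
    (hsc : sc x ≠ 0) (u : ℕ → Y) (v : X) :
    R.functionalVar sc F x u v = sc x * (∑ k ∈ Finset.Icc 1 J, R.dcoef sc F x k *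
      (R.Gx x (u k) v - R.lam k x * R.Qx x (u k) v) + R.Ssum sc F x / sc x * fderiv ℝ sc x v) := by
  have hd : ∀ i : Fin N, R.dcoef sc F x (i + 1)
      = fderiv ℝ F (R.scaledLam sc N x) (Pi.single i 1) := by
    intro i
    rw [dcoef, dif_pos ⟨by omega, by omega⟩]
    rfl
  have hsumN : ∀ f : ℕ → ℝ, ∑ k ∈ Finset.Icc 1 N, f k = ∑ i : Fin N, f (i + 1) := by
    intro f
    rw [Fin.sum_univ_eq_sum_range (fun i => f (i + 1)) N, Finset.range_eq_Ico,
      Finset.sum_Ico_add' f 0 N 1]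
    rfl
  have hJ : ∑ k ∈ Finset.Icc 1 J, R.dcoef sc F x k *
      (R.Gx x (u k) v - R.lam k x * R.Qx x (u k) v)
      = ∑ k ∈ Finset.Icc 1 N, R.dcoef sc F x k *
      (R.Gx x (u k) v - R.lam k x * R.Qx x (u k) v) := by
    symm
    refine Finset.sum_subset (Finset.Icc_subset_Icc le_rfl hNJ) fun k hk hkN => ?_
    rw [Finset.mem_Icc] at hkN
    rw [dcoef, dif_neg hkN, zero_mul]
  have hlin : ∀ w : Fin N → ℝ, fderiv ℝ F (R.scaledLam sc N x) w
      = ∑ i : Fin N, w i * fderiv ℝ F (R.scaledLam sc N x) (Pi.single i 1) := by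
    intro w
    conv_lhs => rw [pi_eq_sum_univ' w, map_sum]
    refine Finset.sum_congr rfl fun i _ => ?_
    rw [map_smul, smul_eq_mul]
  rw [functionalVar, hlin, hJ, Ssum, hsumN, hsumN, mul_add, div_mul_eq_mul_div, mul_div_cancel₀ _ hsc,
    Finset.mul_sum, Finset.sum_mul, ← Finset.sum_add_distrib]
  refine Finset.sum_congr rfl fun i _ => ?_
  rw [hd, scaledVar]
  ring

/-- The Euler–Lagrange equation for points whose Clarke subdifferential contains `0`. -/
theorem StandingAssumptions.exists_mix_of_clarkeSub (hR : R.StandingAssumptions Ω)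
    (hY : ¬ FiniteDimensional ℝ Y) (hΩ : IsOpen Ω) (hx : x ∈ Ω) {sc : X → ℝ} (hsc0 : 0 < sc x)
    (hsc : ContDiffOn ℝ 1 sc Ω) {N : ℕ} (hN : 1 ≤ N) {F : (Fin N → ℝ) → ℝ} (hF : ContDiff ℝ 1 F)
    (hcrit : (0 : X →L[ℝ] ℝ) ∈ clarkeSub (R.functional sc F) x) :
    ∃ (u : ℕ → Y) (dt : ℕ → ℝ), R.OrthonormalFamily x (R.topIdx N x) u ∧
      (∀ i ∈ Finset.Icc 1 (R.clusterIdx N x),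
        (fun k : R.aleph i x => dt k) ∈ Mix (fun k : R.aleph i x => R.dcoef sc F x k)) ∧
      ∑ k ∈ Finset.Icc 1 (R.topIdx N x), dt k • (R.Gx x (u k) - R.lam k x • R.Qx x (u k))
        + (R.Ssum sc F x / sc x) • fderiv ℝ sc x = 0 := by
  classical
  obtain ⟨e, h⟩ := hR.exists_isEigenbasis hY hx
  have hQ := hR.Q_posDef x hx
  let _ : ∀ i, Fintype (R.aleph i x) := fun i => (h.finite_aleph i).fintype
  have hek : ∀ {i : ℕ} (k a : R.aleph i x), e (a - 1) ∈ R.eigenspace k x := by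
    intro i k a
    have h1 := h.mem_eigenspace (a - 1)
    rw [Nat.sub_add_cancel a.2.1] at h1
    rwa [eigenspace_congr (k := k) (l := a) (by rw [k.2.2, a.2.2])]
  have heo : ∀ {i : ℕ} (a b : R.aleph i x),
      R.B x (e (a - 1)) (e (b - 1)) = if a = b then 1 else 0 := by
    intro i a b
    rw [h.orth]
    refine if_congr ⟨fun hab => Subtype.ext ?_, fun hab => by rw [hab]⟩ rfl rfl
    have := a.2.1
    have := b.2.1
    omega
  -- the forms `G_x - μ_i Q_x` on the `i`-th eigenspace, in the eigenbasis
  let ψ : ∀ i : Finset.Icc 1 (R.clusterIdx N x), R.aleph i x → R.aleph i x → Module.Dual ℝ X :=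
    fun i a b => (R.Gamx x (e (a - 1)) (e (b - 1))
      - R.mu x i • R.Bx x (e (a - 1)) (e (b - 1)) : X →L[ℝ] ℝ)
  have hψ : ∀ (i : Finset.Icc 1 (R.clusterIdx N x)) (k : R.aleph i x) (c : R.aleph i x → ℝ)
      (v : X), R.Gx x (∑ a, c a • e (a - 1)) v - R.lam k x * R.Qx x (∑ a, c a • e (a - 1)) v
        = ∑ a, ∑ b, c a * c b * ψ i a b v := by
    intro i k c v
    rw [hR.Gx_sum hx c (w := fun a : R.aleph i x => e (a - 1)) (fun a => h.mem _),
      hR.Qx_sum hx c (fun a : R.aleph i x => e (a - 1)), k.2.2]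
    simp only [sum_apply, smul_apply, smul_eq_mul, ψ,
      ContinuousLinearMap.coe_coe, sub_apply, Finset.mul_sum,
      ← Finset.sum_sub_distrib]
    exact Finset.sum_congr rfl fun a _ => Finset.sum_congr rfl fun b _ => by ring
  obtain ⟨O, hO, dt, hdt, hsum⟩ := exists_mix_eq_zero
    (fun (i : Finset.Icc 1 (R.clusterIdx N x)) (k : R.aleph i x) => R.dcoef sc F x k) ψ
    (((R.Ssum sc F x / sc x) • fderiv ℝ sc x : X →L[ℝ] ℝ) : Module.Dual ℝ X) (by
      intro v
      obtain ⟨u, hu, hge⟩ := hR.exists_functionalVar_nonneg hY hΩ hx hsc hF (h.le_topIdx hN)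
        hcrit v
      rw [functionalVar_eq (h.le_topIdx hN) hsc0.ne', h.sum_Icc_topIdx hN] at hge
      have hmem : ∀ (i : Finset.Icc 1 (R.clusterIdx N x)) (k : R.aleph i x),
          (k : ℕ) ∈ Finset.Icc 1 (R.topIdx N x) := fun i k => h.mem_Icc_of_mem_aleph hN i.2 k.2
      have hexp : ∀ (i : Finset.Icc 1 (R.clusterIdx N x)) (k : R.aleph i x),
          u k = ∑ a : R.aleph i x, R.B x (u k) (e (a - 1)) • e (a - 1) := fun i k =>
        h.eq_sum_aleph hQ k.2 (hu.1.1 k (hmem i k))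
      refine ⟨fun i => Matrix.of fun k a => R.B x (u k) (e (a - 1)), fun i => ?_, ?_⟩
      · rw [Matrix.mem_orthogonalGroup_iff]
        ext k l
        rw [Matrix.mul_apply, Matrix.one_apply]
        simp only [Matrix.transpose_apply, Matrix.of_apply]
        have h1 := B_sum_sum (R := R) x (fun a : R.aleph i x => R.B x (u k) (e (a - 1)))
          (fun a : R.aleph i x => R.B x (u l) (e (a - 1))) (fun a => e (a - 1))
        rw [← hexp, ← hexp] at h1
        simp only [heo, mul_ite, mul_one, mul_zero, Finset.sum_ite_eq, Finset.mem_univ,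
          if_true] at h1
        rw [← h1]
        split_ifs with hkl
        · rw [hkl, B_self, hu.2 _ (hmem i l)]
        · exact hu.1.2 _ (hmem i k) _ (hmem i l) fun hkl' => hkl (Subtype.ext hkl')
      · have h2 := nonneg_of_mul_nonneg_right hge hsc0
        refine h2.trans_eq ?_
        congr 1
        refine Finset.sum_congr rfl fun i _ => Finset.sum_congr rfl fun k _ => ?_
        congr 1
        conv_lhs => rw [hexp i k]
        exact hψ i k _ v)
  obtain ⟨u, hu⟩ := h.exists_glue
    (fun (i : Finset.Icc 1 (R.clusterIdx N x)) (k : R.aleph i x) => ∑ a : R.aleph i x, O i k a • e (a - 1))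
  obtain ⟨dt', hdt'⟩ := h.exists_glue dt
  refine ⟨u, dt', ⟨⟨fun k hk => ?_, fun k hk l hl hkl => ?_⟩, fun k hk => ?_⟩, fun i hi => ?_, ?_⟩
  · obtain ⟨i, hki⟩ := h.exists_mem_aleph hN hk
    rw [hu i ⟨k, hki⟩]
    exact sum_mem_eigenspace _ fun a => hek ⟨k, hki⟩ a
  · obtain ⟨i, hki⟩ := h.exists_mem_aleph hN hk
    obtain ⟨j, hlj⟩ := h.exists_mem_aleph hN hl
    rw [hu i ⟨k, hki⟩, hu j ⟨l, hlj⟩]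
    by_cases hij : i = j
    · subst hij
      rw [B_sum_sum]
      simp only [heo, mul_ite, mul_one, mul_zero, Finset.sum_ite_eq, Finset.mem_univ, if_true]
      rw [sum_row_mul_of_orthogonal (hO i), if_neg fun hc => hkl (Subtype.ext_iff.1 hc)]
    · simp only [B_eq, map_sum, LinearMap.sum_apply, map_smul, LinearMap.smul_apply, smul_eq_mul,
        Finset.mul_sum]
      refine Finset.sum_eq_zero fun a _ => Finset.sum_eq_zero fun b _ => ?_
      rw [← B_eq, h.orth, if_neg, mul_zero, mul_zero]
      intro hab
      apply hij
      have ha := (h.mem_aleph_iff (Finset.mem_Icc.1 i.2).1).1 b.2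
      have hb := (h.mem_aleph_iff (Finset.mem_Icc.1 j.2).1).1 a.2
      have hab' : (a : ℕ) = b := by omega
      exact Subtype.ext (by rw [← ha.2, ← hb.2, hab'])
  · obtain ⟨i, hki⟩ := h.exists_mem_aleph hN hk
    rw [hu i ⟨k, hki⟩, ← B_self, B_sum_sum]
    simp only [heo, mul_ite, mul_one, mul_zero, Finset.sum_ite_eq, Finset.mem_univ, if_true]
    rw [sum_row_mul_of_orthogonal (hO i), if_pos rfl]
  · convert hdt ⟨i, hi⟩ using 1
    exact funext fun k => hdt' ⟨i, hi⟩ k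
  · ext v
    have h3 := LinearMap.congr_fun hsum v
    rw [h.sum_Icc_topIdx hN]
    simp only [add_apply, sum_apply,
      smul_apply, sub_apply, smul_eq_mul, zero_apply,
      LinearMap.add_apply, LinearMap.sum_apply, LinearMap.smul_apply, LinearMap.zero_apply,
      ContinuousLinearMap.coe_coe] at h3 ⊢
    rw [← h3]
    congr 1
    refine Finset.sum_congr rfl fun i _ => Finset.sum_congr rfl fun k _ => ?_
    rw [hdt' i k, hu i k, hψ i k]

/-- The same conclusion for either Clarke differential: for the superdifferential, change the
signs of `F` and of the coefficients. -/
theorem StandingAssumptions.exists_mix_of_critical (hR : R.StandingAssumptions Ω)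
    (hY : ¬ FiniteDimensional ℝ Y) (hΩ : IsOpen Ω) (hx : x ∈ Ω) {sc : X → ℝ} (hsc0 : 0 < sc x)
    (hsc : ContDiffOn ℝ 1 sc Ω) {N : ℕ} (hN : 1 ≤ N) {F : (Fin N → ℝ) → ℝ} (hF : ContDiff ℝ 1 F)
    (hcrit : IsClarkeCritical (R.functional sc F) x) :
    ∃ (u : ℕ → Y) (dt : ℕ → ℝ), R.OrthonormalFamily x (R.topIdx N x) u ∧
      (∀ i ∈ Finset.Icc 1 (R.clusterIdx N x),
        (fun k : R.aleph i x => dt k) ∈ Mix (fun k : R.aleph i x => R.dcoef sc F x k)) ∧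
      ∑ k ∈ Finset.Icc 1 (R.topIdx N x), dt k • (R.Gx x (u k) - R.lam k x • R.Qx x (u k))
        + (R.Ssum sc F x / sc x) • fderiv ℝ sc x = 0 := by
  rcases hcrit with hsub | hsuper
  · exact hR.exists_mix_of_clarkeSub hY hΩ hx hsc0 hsc hN hF hsub
  obtain ⟨u, dt, hu, hdt, hsum⟩ := hR.exists_mix_of_clarkeSub hY hΩ hx hsc0 hsc hN hF.neg
    (zero_mem_clarkeSub_neg hsuper)
  have hd : ∀ k, R.dcoef sc (fun y => -F y) x k = -R.dcoef sc F x k := by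
    intro k
    simp only [dcoef]
    split_ifs
    · rw [fderiv_fun_neg, neg_apply]
    · rw [neg_zero]
  refine ⟨u, fun k => -dt k, hu, fun i hi => ?_, ?_⟩
  · refine neg_mem_Mix (dt := fun k : R.aleph i x => dt k) ?_
    have := hdt i hi
    simp only [hd] at this
    exact this
  · have hS : R.Ssum sc (fun y => -F y) x = -R.Ssum sc F x := by
      simp only [Ssum, hd, neg_mul, Finset.sum_neg_distrib]
    have hneg : ∀ v : ℕ → X →L[ℝ] ℝ, ∑ k ∈ Finset.Icc 1 (R.topIdx N x), (-dt k) • v k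
        = -∑ k ∈ Finset.Icc 1 (R.topIdx N x), dt k • v k := fun v => by
      rw [← Finset.sum_neg_distrib]
      exact Finset.sum_congr rfl fun k _ => by
        ext w
        simp only [smul_apply, neg_apply, smul_eq_mul, neg_mul]
    rw [hS, neg_div, neg_smul] at hsum
    rw [hneg, ← neg_eq_zero, neg_add, neg_neg]
    exact hsum

end Derivatives

end RayleighFamily

theorem theorem3p12
    {X Y : Type*} [NormedAddCommGroup X] [NormedSpace ℝ X] [CompleteSpace X]
    [AddCommGroup Y] [Module ℝ Y] (hY : ¬ FiniteDimensional ℝ Y)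
    (Ω : Set X) (hΩ : IsOpen Ω)
    (R : RayleighFamily X Y) (hR : R.StandingAssumptions Ω)
    (sc : X → ℝ) (hsc_pos : ∀ y ∈ Ω, 0 < sc y) (hsc : ContDiffOn ℝ 1 sc Ω)
    (N : ℕ) (hN : 1 ≤ N) (F : (Fin N → ℝ) → ℝ) (hF : ContDiff ℝ 1 F)
    (x : X) (hx : x ∈ Ω) (hcrit : IsClarkeCritical (R.functional sc F) x) :
    ∃ (u : ℕ → Y) (dt : ℕ → ℝ),
      -- (A)
      R.OrthonormalFamily x (R.topIdx N x) u ∧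
      (∀ i ∈ Finset.Icc 1 (R.clusterIdx N x),
        (fun k : R.aleph i x => dt k) ∈ Mix (fun k : R.aleph i x => R.dcoef sc F x k)) ∧
      ∑ k ∈ Finset.Icc 1 (R.topIdx N x), dt k • R.Gx x (u k)
          + (R.Ssum sc F x / sc x) • fderiv ℝ sc x
        = ∑ i ∈ Finset.Icc 1 (R.clusterIdx N x),
            R.mu x i • ∑ᶠ k ∈ R.aleph i x, dt k • R.Qx x (u k) ∧
      ∃ (φ : ℕ → Y) (ε : ℕ → ℝ),
        -- (B)
        R.OrthogonalFamily x (R.topIdx N x) φ ∧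
        (∀ k ∈ Finset.Icc 1 (R.topIdx N x), ε k ∈ ({0, 1, -1} : Set ℝ)) ∧
        ∑ k ∈ Finset.Icc 1 (R.topIdx N x), ε k • R.Gx x (φ k)
            + (R.csign sc F x / sc x) • fderiv ℝ sc x
          = ∑ i ∈ Finset.Icc 1 (R.clusterIdx N x),
              R.mu x i • ∑ᶠ k ∈ R.aleph i x, ε k • R.Qx x (φ k) ∧
        -- (C)
        (∀ k ∈ Finset.Icc 1 (R.topIdx N x),
          (R.Ssum sc F x = 0 → R.Q x (φ k) = |dt k|) ∧
          (R.Ssum sc F x ≠ 0 → R.Q x (φ k) = |dt k| / |R.Ssum sc F x|)) ∧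
        -- (D)
        (∀ i ∈ Finset.Icc 1 (R.clusterIdx N x),
          (∀ k ∈ R.aleph i x, 0 < R.dcoef sc F x k) →
            ∀ k ∈ R.aleph i x, 0 < dt k ∧ ε k = 1) := by
  classical
  obtain ⟨u, dt, hu, hdt, hsum⟩ :=
    hR.exists_mix_of_critical hY hΩ hx (hsc_pos x hx) hsc hN hF hcrit
  obtain ⟨e, he⟩ := hR.exists_isEigenbasis hY hx
  have hA : ∑ k ∈ Finset.Icc 1 (R.topIdx N x), dt k • R.Gx x (u k)
      + (R.Ssum sc F x / sc x) • fderiv ℝ sc x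
      = ∑ k ∈ Finset.Icc 1 (R.topIdx N x), R.lam k x • dt k • R.Qx x (u k) := by
    rw [← sub_eq_zero, ← hsum]
    simp only [smul_sub, Finset.sum_sub_distrib, smul_comm (R.lam _ x) (dt _)]
    abel
  -- `ρ` turns (A) into (B): multiplying by it replaces `S` by `c` and `dt k` by `ε k * Q(φ k)`
  set ρ : ℝ := if R.Ssum sc F x = 0 then 1 else |R.Ssum sc F x|⁻¹ with hρ
  have hρ0 : 0 < ρ := by
    rw [hρ]
    split_ifs with hS
    · exact one_pos
    · exact inv_pos.2 (abs_pos.2 hS)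
  have hcs : R.csign sc F x = ρ * R.Ssum sc F x := by
    rw [RayleighFamily.csign, hρ]
    split_ifs with hS
    · rw [hS, mul_zero]
    · rw [div_eq_inv_mul]
  have hsq : ∀ k, √(|dt k| * ρ) ^ 2 = |dt k| * ρ := fun k =>
    Real.sq_sqrt (mul_nonneg (abs_nonneg _) hρ0.le)
  have hsign : ∀ k, Real.sign (dt k) * (|dt k| * ρ) = ρ * dt k := fun k => by
    rcases lt_trichotomy (dt k) 0 with h0 | h0 | h0
    · rw [Real.sign_of_neg h0, abs_of_neg h0]; ring
    · simp [h0]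
    · rw [Real.sign_of_pos h0, abs_of_pos h0]; ring
  refine ⟨u, dt, hu, hdt, by rw [he.sum_mu_smul hN]; exact hA,
    fun k => √(|dt k| * ρ) • u k, fun k => Real.sign (dt k),
    ⟨fun k hk => RayleighFamily.smul_mem_eigenspace _ (hu.1.1 k hk), fun k hk l hl hkl => ?_⟩,
    fun k _ => ?_, ?_, fun k hk => ?_, fun i hi hpos k hk => ?_⟩
  · have h0 := hu.1.2 k hk l hl hkl
    rw [R.B_eq] at h0 ⊢
    rw [map_smul, map_smul, LinearMap.smul_apply, h0, smul_zero, smul_zero]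
  · rcases Real.sign_apply_eq (dt k) with h1 | h1 | h1 <;> simp [h1]
  · rw [he.sum_mu_smul hN]
    have hG : ∀ k ∈ Finset.Icc 1 (R.topIdx N x),
        Real.sign (dt k) • R.Gx x (√(|dt k| * ρ) • u k) = ρ • dt k • R.Gx x (u k) := by
      intro k hk
      rw [hR.Gx_smul hx _ (R.mem_eigenspace.1 (hu.1.1 k hk)).1, hsq, smul_smul, smul_smul, hsign]
    have hQ : ∀ k ∈ Finset.Icc 1 (R.topIdx N x),
        R.lam k x • Real.sign (dt k) • R.Qx x (√(|dt k| * ρ) • u k)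
          = ρ • R.lam k x • dt k • R.Qx x (u k) := by
      intro k _
      rw [hR.Qx_smul hx, hsq, smul_smul (Real.sign _), hsign, mul_smul, smul_comm (R.lam k x) ρ]
    rw [Finset.sum_congr rfl hG, Finset.sum_congr rfl hQ, ← Finset.smul_sum, ← Finset.smul_sum,
      ← hA, smul_add, smul_smul ρ (_ / _), ← mul_div_assoc, ← hcs]
  · have hQk : R.Q x (√(|dt k| * ρ) • u k) = |dt k| * ρ := by
      rw [R.Q_smul, hsq, hu.2 k hk, mul_one]
    refine ⟨fun hS => ?_, fun hS => ?_⟩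
    · rw [hQk, hρ, if_pos hS, mul_one]
    · rw [hQk, hρ, if_neg hS, div_eq_mul_inv]
  · have hp : 0 < dt k := pos_of_mem_Mix (hdt i hi) (fun k => hpos k k.2) ⟨k, hk⟩
    exact ⟨hp, Real.sign_of_pos hp⟩
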